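/- Let $0<q<1$ and let $\omega$ be a real weight on the lattice $q^{\mathbb Z/2}=\{q^{i/2}: i\in\mathbb Z\}$. Write $$\int_0^\infty \phi(x)\,d_{q^{1/2}}x=(1-q^{1/2})\sum_{i\in\mathbb Z}q^{i/2}\phi(q^{i/2}).$$ Define, on the lattice, $F(x)=1+q^{1/2}$ for $x\in q^{\mathbb Z}$, $F(x)=0$ for $x\in q^{\mathbb Z+1/2}$, and $$s(q^{i/2},q^{j/2})=(1+q^{1/2})^2\begin{cases}1,& i=2a+1,\ j=2b,\ a\ge b,\\ -1,& i=2b,\ j=2a+1,\ a\ge b,\\ 0,&\text{otherwise,}\end{cases}$$ and the skew inner product $\langle\phi,\psi\rangle=\int_0^\infty\!\int_0^\infty\phi(x)\psi(y)s(x,y)\omega(x)\omega(y)\,d_{q^{1/2}}x\,d_{q^{1/2}}y$. Let $n\ge 0$, and assume that the moments $\int_0^\infty x^j\omega(x)\,d_{q^{1/2}}x$, $0\le j\le 2n$, converge absolutely. Let $Q_0,\dots,Q_{2n}$ be real monic polynomials, $\deg Q_k=k$, with $$\langle Q_{2m},Q_{2l}\rangle=\langle Q_{2m+1},Q_{2l+1}\rangle=0,\qquad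 \langle Q_{2m},Q_{2l+1}\rangle=u_m\delta_{m,l}$$ for all indices at most $2n$, where $u_0,\dots,u_{n-1}$ are nonzero. Assume that $$\beta_{2n}:=\int_0^\infty Q_{2n}(x)F(x)\omega(x)\,d_{q^{1/2}}x\neq 0,$$ and put $$\hat Q_k(x)=Q_k(x)-\frac{1}{\beta_{2n}}\Big(\int_0^\infty Q_k(y)F(y)\omega(y)\,d_{q^{1/2}}y\Big)Q_{2n}(x)\quad(0\le k\le 2n-1),\qquad \hat Q_{2n}=Q_{2n},$$ $$\Phi_k(x)=\int_0^\infty\hat Q_k(y)s(y,x)\omega(y)\,d_{q^{1/2}}y\quad(0\le k\le 2n).$$ Define $$K(x,y)=\sum_{k=0}^{n-1}\frac1{u_k}\big(\hat Q_{2k}(x)\hat Q_{2k+1}(y)-\hat Q_{2k+1}(x)\hat Q_{2k}(y)\big),$$ $$J(x,y)=\sum_{k=0}^{n-1}\frac1{u_k}\big(\Phi_{2k}(x)\hat Q_{2k+1}(y)-\Phi_{2k+1}(x)\hat Q_{2k}(y)\big)+\frac1{\beta_{2n}}F(x)\hat Q_{2n}(y),$$ $$I(x,y)=\sum_{k=0}^{n-1}\frac1{u_k}\big(\Phi_{2k+1}(x)\Phi_{2k}(y)-\Phi_{2k}(x)\Phi_{2k+1}(y)\big)+s(x,y)+\frac1{\beta_{2n}}\big(\Phi_{2n}(x)F(y)-F(x)\Phi_{2n}(y)\big),$$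 $$\tilde K_{2n+1}(x,y)=\begin{pmatrix}K(x,y)&J(y,x)\\-J(x,y)&-I(x,y)\end{pmatrix}.$$ For $z_1,\dots,z_{2n+1}\in q^{\mathbb Z/2}$ let $$p(z_1,\dots,z_{2n+1})=\mathrm{Pf}\begin{bmatrix}[s(z_i,z_j)]&[F(z_i)]\\-[F(z_j)]^{\top}&0\end{bmatrix}_{i,j=1}^{2n+1}\ \prod_{1\le i<j\le 2n+1}(z_j-z_i)\ \prod_{i=1}^{2n+1}\omega(z_i),$$ $$\tau_{2n+1}=\frac1{(2n+1)!}\int_{(0,\infty)^{2n+1}}p(z_1,\dots,z_{2n+1})\prod_{i=1}^{2n+1}d_{q^{1/2}}z_i,$$ $$\rho_{2n+1,k}(z_1,\dots,z_k)=\frac1{(2n+1-k)!\,\tau_{2n+1}}\int_{(0,\infty)^{2n+1-k}}p(z_1,\dots,z_{2n+1})\prod_{i=k+1}^{2n+1}d_{q^{1/2}}z_i .$$ Then these multiple integrals converge absolutely, and the following hold. 1. $\tau_{2n+1}=\beta_{2n}\prod_{j=0}^{n-1}u_j$ (in particular $\tau_{2n+1}\ne0$). 2. The kernel is skew symmetric: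 $\tilde K_{2n+1}(x,y)^{\top}=-\tilde K_{2n+1}(y,x)$ for all $x,y\in q^{\mathbb Z/2}$. 3. For all $0\le k\le 2n+1$ and all $z_1,\dots,z_k\in q^{\mathbb Z/2}$, $$\rho_{2n+1,k}(z_1,\dots,z_k)=\prod_{l=1}^k\omega(z_l)\ \mathrm{Pf}\big[\tilde K_{2n+1}(z_i,z_j)\big]_{i,j=1}^k,$$ the Pfaffian being that of the $2k\times 2k$ matrix with $2\times2$ blocks $\tilde K_{2n+1}(z_i,z_j)$. -/

import Mathlib

open scoped BigOperators

namespace QOrth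

noncomputable section

/-- The Pfaffian of a matrix of even size `2m`,
`1 / (2^m m!) * ∑ σ, sign σ * ∏ i, A (σ (2i)) (σ (2i+1))`. -/
def pfaffian {m : ℕ} (A : Matrix (Fin (2 * m)) (Fin (2 * m)) ℝ) : ℝ :=
  (1 / (2 ^ m * (m.factorial : ℝ))) *
    ∑ σ : Equiv.Perm (Fin (2 * m)), ((Equiv.Perm.sign σ : ℤ) : ℝ) *
      ∏ i : Fin m, A (σ ⟨2 * i.1, by omega⟩) (σ ⟨2 * i.1 + 1, by omega⟩)

/-- The point `q^(i/2)` of the exponential lattice `q^(ℤ/2)`. Functions on the lattice are written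
below as functions of the index `i : ℤ`. -/
def pt (q : ℝ) (i : ℤ) : ℝ := (√q) ^ i

/-- The Jackson integral `∫_0^∞ f(x) d_{√q} x = (1 - √q) ∑_i q^(i/2) f(q^(i/2))`. -/
def jackson (q : ℝ) (f : ℤ → ℝ) : ℝ := (1 - √q) * ∑' i : ℤ, pt q i * f i

/-- The summand of the `m`-fold Jackson integral. -/
def jacksonTerm (q : ℝ) {m : ℕ} (f : (Fin m → ℤ) → ℝ) (w : Fin m → ℤ) : ℝ :=
  (∏ l, (1 - √q) * pt q (w l)) * f w

/-- The `m`-fold Jackson integral over `(0,∞)^m` with respect to `d_{√q}`. -/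
def jacksonMulti (q : ℝ) {m : ℕ} (f : (Fin m → ℤ) → ℝ) : ℝ :=
  ∑' w : Fin m → ℤ, jacksonTerm q f w

/-- The skew symmetric kernel `s(q^(i/2), q^(j/2))`: it is `(1+√q)^2` if `i = 2a+1`, `j = 2b` with
`a ≥ b`, it is `-(1+√q)^2` if `i = 2b`, `j = 2a+1` with `a ≥ b`, and `0` otherwise. -/
def sKer (q : ℝ) (i j : ℤ) : ℝ :=
  (1 + √q) ^ 2 *
    (if i % 2 = 1 ∧ j % 2 = 0 ∧ j / 2 ≤ i / 2 then 1
     else if i % 2 = 0 ∧ j % 2 = 1 ∧ i / 2 ≤ j / 2 then -1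
     else 0)

/-- The function `F`: it is `1 + √q` on `q^ℤ` and `0` on `q^(ℤ+1/2)`. -/
def Ffun (q : ℝ) (i : ℤ) : ℝ := if i % 2 = 0 then 1 + √q else 0

/-- The skew inner product
`⟨φ, ψ⟩ = ∫∫ φ(x) ψ(y) s(x,y) ω(x) ω(y) d_{√q} x d_{√q} y`. -/
def skewInner (q : ℝ) (ω : ℝ → ℝ) (φ ψ : Polynomial ℝ) : ℝ :=
  jackson q fun i => jackson q fun j =>
    φ.eval (pt q i) * ψ.eval (pt q j) * sKer q i j * ω (pt q i) * ω (pt q j)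

/-- The moments of `ω` of order at most `d` on the lattice `q^(ℤ/2)` converge (absolutely). -/
def HasMoments (q : ℝ) (ω : ℝ → ℝ) (d : ℕ) : Prop :=
  ∀ j ≤ d, Summable fun i : ℤ => pt q i * (pt q i ^ j * ω (pt q i))

/-- `Q 0, …, Q d` are monic skew orthogonal polynomials, `Q k` of degree `k`, with nonzero
normalization factors `u`. -/
structure IsMonicSkewOrthogonal (q : ℝ) (ω : ℝ → ℝ) (d : ℕ)
    (Q : ℕ → Polynomial ℝ) (u : ℕ → ℝ) : Prop where
  monic : ∀ k ≤ d, (Q k).Monic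
  natDegree_eq : ∀ k ≤ d, (Q k).natDegree = k
  even_even : ∀ m l, 2 * m ≤ d → 2 * l ≤ d → skewInner q ω (Q (2 * m)) (Q (2 * l)) = 0
  odd_odd : ∀ m l, 2 * m + 1 ≤ d → 2 * l + 1 ≤ d →
    skewInner q ω (Q (2 * m + 1)) (Q (2 * l + 1)) = 0
  even_odd : ∀ m l, 2 * m ≤ d → 2 * l + 1 ≤ d →
    skewInner q ω (Q (2 * m)) (Q (2 * l + 1)) = if m = l then u m else 0
  factor_ne_zero : ∀ m, 2 * m + 1 ≤ d → u m ≠ 0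

/-- The matrix `X = [[s(z_i,z_j)], [F(z_i)]; [-F(z_j)], 0]` of size `2n+2`. -/
def borderedMatrix (q : ℝ) (n : ℕ) (z : Fin (2 * n + 1) → ℤ) :
    Matrix (Fin (2 * (n + 1))) (Fin (2 * (n + 1))) ℝ := fun a b =>
  if ha : a.1 < 2 * n + 1 then
    if hb : b.1 < 2 * n + 1 then sKer q (z ⟨a.1, ha⟩) (z ⟨b.1, hb⟩) else Ffun q (z ⟨a.1, ha⟩)
  else
    if hb : b.1 < 2 * n + 1 then -Ffun q (z ⟨b.1, hb⟩) else 0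

/-- The unnormalized joint density of `2n+1` particles,
`Pf[X] * ∏_{i<j} (z_j - z_i) * ∏_i ω(z_i)`. -/
def jointWeight (q : ℝ) (ω : ℝ → ℝ) (n : ℕ) (z : Fin (2 * n + 1) → ℤ) : ℝ :=
  pfaffian (borderedMatrix q n z) *
    (∏ i, ∏ j ∈ Finset.Ioi i, (pt q (z j) - pt q (z i))) * ∏ i, ω (pt q (z i))

/-- The partition function `τ_{2n+1} = 1/(2n+1)! ∫ Pf[X] ∏_{i<j} (z_j - z_i) ∏ ω(z_i) d_{√q} z_i`. -/
def partitionFunction (q : ℝ) (ω : ℝ → ℝ) (n : ℕ) : ℝ :=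
  (1 / ((2 * n + 1).factorial : ℝ)) * jacksonMulti q (jointWeight q ω n)

/-- The configuration `(z_1, …, z_k, w_1, …, w_{N-k})`. -/
def extend {N k : ℕ} (z : Fin k → ℤ) (w : Fin (N - k) → ℤ) : Fin N → ℤ := fun i =>
  if h : i.1 < k then z ⟨i.1, h⟩ else w ⟨i.1 - k, by omega⟩

/-- The `k`-point correlation function `ρ_{2n+1,k}` at the lattice points with indices `z`:
`1 / ((2n+1-k)! τ_{2n+1})` times the integral of the joint density over the last `2n+1-k`
variables. -/
def corr (q : ℝ) (ω : ℝ → ℝ) (n k : ℕ) (z : Fin k → ℤ) : ℝ :=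
  (1 / (((2 * n + 1 - k).factorial : ℝ) * partitionFunction q ω n)) *
    jacksonMulti q fun w : Fin (2 * n + 1 - k) → ℤ => jointWeight q ω n (extend z w)

/-- The single integral `∫ Q_k(x) F(x) ω(x) d_{√q} x`; it is `β_{2n}` for `k = 2n`. -/
def beta (q : ℝ) (ω : ℝ → ℝ) (Q : ℕ → Polynomial ℝ) (k : ℕ) : ℝ :=
  jackson q fun i => (Q k).eval (pt q i) * Ffun q i * ω (pt q i)

/-- The modified polynomials: `Q̂_k = Q_k - (∫ Q_k F ω / β_{2n}) Q_{2n}` for `k < 2n`, and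
`Q̂_{2n} = Q_{2n}`. -/
def Qhat (q : ℝ) (ω : ℝ → ℝ) (n : ℕ) (Q : ℕ → Polynomial ℝ) (k : ℕ) : Polynomial ℝ :=
  if k = 2 * n then Q (2 * n)
  else Q k - Polynomial.C (beta q ω Q k / beta q ω Q (2 * n)) * Q (2 * n)

/-- `Φ_k(x) = ∫ Q̂_k(y) s(y,x) ω(y) d_{√q} y`. -/
def Phi (q : ℝ) (ω : ℝ → ℝ) (n : ℕ) (Q : ℕ → Polynomial ℝ) (k : ℕ) (x : ℤ) : ℝ :=
  jackson q fun i => (Qhat q ω n Q k).eval (pt q i) * sKer q i x * ω (pt q i)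

/-- The kernel `K^{odd}_{2n+1}`. -/
def Kodd (q : ℝ) (ω : ℝ → ℝ) (n : ℕ) (Q : ℕ → Polynomial ℝ) (u : ℕ → ℝ) (x y : ℤ) : ℝ :=
  ∑ k ∈ Finset.range n, (1 / u k) *
    ((Qhat q ω n Q (2 * k)).eval (pt q x) * (Qhat q ω n Q (2 * k + 1)).eval (pt q y)
      - (Qhat q ω n Q (2 * k + 1)).eval (pt q x) * (Qhat q ω n Q (2 * k)).eval (pt q y))

/-- The kernel `J^{odd}_{2n+1}`. -/
def Jodd (q : ℝ) (ω : ℝ → ℝ) (n : ℕ) (Q : ℕ → Polynomial ℝ) (u : ℕ → ℝ) (x y : ℤ) : ℝ :=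
  (∑ k ∈ Finset.range n, (1 / u k) *
    (Phi q ω n Q (2 * k) x * (Qhat q ω n Q (2 * k + 1)).eval (pt q y)
      - Phi q ω n Q (2 * k + 1) x * (Qhat q ω n Q (2 * k)).eval (pt q y)))
  + (1 / beta q ω Q (2 * n)) * (Ffun q x * (Qhat q ω n Q (2 * n)).eval (pt q y))

/-- The kernel `I^{odd}_{2n+1}`. -/
def Iodd (q : ℝ) (ω : ℝ → ℝ) (n : ℕ) (Q : ℕ → Polynomial ℝ) (u : ℕ → ℝ) (x y : ℤ) : ℝ :=
  (∑ k ∈ Finset.range n, (1 / u k) *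
    (Phi q ω n Q (2 * k + 1) x * Phi q ω n Q (2 * k) y
      - Phi q ω n Q (2 * k) x * Phi q ω n Q (2 * k + 1) y))
  + sKer q x y
  + (1 / beta q ω Q (2 * n)) *
    (Phi q ω n Q (2 * n) x * Ffun q y - Ffun q x * Phi q ω n Q (2 * n) y)

/-- The `2 × 2` matrix kernel `K̃_{2n+1}(x,y)`. -/
def Ktilde (q : ℝ) (ω : ℝ → ℝ) (n : ℕ) (Q : ℕ → Polynomial ℝ) (u : ℕ → ℝ) (x y : ℤ) :
    Matrix (Fin 2) (Fin 2) ℝ :=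
  !![Kodd q ω n Q u x y, Jodd q ω n Q u y x;
     -Jodd q ω n Q u x y, -Iodd q ω n Q u x y]

/-- The `2k × 2k` matrix whose `(i,j)` block of size `2 × 2` is `κ (z_i) (z_j)`. -/
def blockMatrix {k : ℕ} (κ : ℤ → ℤ → Matrix (Fin 2) (Fin 2) ℝ) (z : Fin k → ℤ) :
    Matrix (Fin (2 * k)) (Fin (2 * k)) ℝ := fun a b =>
  κ (z ⟨a.1 / 2, by omega⟩) (z ⟨b.1 / 2, by omega⟩)
    ⟨a.1 % 2, Nat.mod_lt _ two_pos⟩ ⟨b.1 % 2, Nat.mod_lt _ two_pos⟩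

end

end QOrth

namespace QOrth

/-! The odd number of particles is made even by adjoining to the lattice a point `none` of weight
one with s(x, none) = F(x). The bordered matrix then consists of the values of the extended s at the
2n+1 particles and `none`. Subtracting multiples of Q_{2n} leaves all skew products unchanged,
because Q_{2n} is skew orthogonal to every Q_k, and the multiples are chosen so that Q̂_k integrates
to zero against F for k < 2n. Hence Q̂_0, ..., Q̂_{2n} and the indicator of `none` are skew
orthogonal for the extended form, with factors u_0, ..., u_{n-1}, β_{2n} (`ensemble`).

Column operations make the Vandermonde product a determinant in these functions, and this
determinant is a constant times the Pfaffian of the scalar kernel (`pf_symp_eq_det`,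
`vandermonde_eq`). The density is therefore τ times Pf[K] Pf[s] times weights, and variables have to
be integrated out of a product of two Pfaffians.

This is `hasSum_mixed`, which is proved by treating the fixed points x of Pf[K] and y of Pf[s] as
independent lists. Expand Pf[s] along the row of a point of y. A pairing with another point of y
shortens y. A pairing with an integration variable v gives an integral against s(y, v), which turns
the K-row at v into a row of the second kind at y, up to terms in s (`hasSum_mixed_cons`). When y is
empty, the reproducing property and the trace of the kernel produce a factor 2m - |x|
(`hasSum_mixed_singleton`). The rank of K, at most 2m, makes the induction end (`mixed_eq_zero`).

Finally `none` is removed: configurations in which it occurs twice contribute zero, and its row in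
the matrix kernel is a signed unit vector (`mixed_none_cons`). The case of no fixed points gives the
partition function. -/

lemma hasSum_of_eq {ι : Type*} {f g : ι → ℝ} {a b : ℝ} (h : HasSum f a) (hf : ∀ x, g x = f x)
    (hab : b = a) : HasSum g b := by
  rw [hab, funext hf]
  exact h

/-! ### Pfaffians of lists by row expansion, and alternating functions of lists. -/

section ListPfaffian

variable {α γ : Type*}

/-- The alternating sum `∑ j, (-1)^j f (l j) (l without l j)`. -/
def lap (f : α → List α → ℝ) : List α → ℝ
  | [] => 0
  | a :: l => f a l - lap (fun b t => f b (a :: t)) l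

/-- The sum `∑ j, f (l j) (l without l j)`. -/
def splitSum (f : α → List α → ℝ) : List α → ℝ
  | [] => 0
  | a :: l => f a l + splitSum (fun b t => f b (a :: t)) l

@[simp] lemma lap_nil (f : α → List α → ℝ) : lap f [] = 0 := rfl

lemma lap_cons (f : α → List α → ℝ) (a : α) (l : List α) :
    lap f (a :: l) = f a l - lap (fun b t => f b (a :: t)) l := rfl

lemma lap_congr {f g : α → List α → ℝ} {l : List α}
    (h : ∀ e t, (e :: t).Perm l → f e t = g e t) : lap f l = lap g l := by
  induction l generalizing f g with
  | nil => rfl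
  | cons a l ih =>
    rw [lap_cons, lap_cons, h a l (List.Perm.refl _)]
    congr 1
    apply ih
    intro e t hp
    exact h e (a :: t) ((List.Perm.swap a e t).trans (hp.cons a))

lemma lap_add (f g : α → List α → ℝ) (l : List α) :
    lap (fun e t => f e t + g e t) l = lap f l + lap g l := by
  induction l generalizing f g with
  | nil => simp
  | cons a l ih => rw [lap_cons, lap_cons, lap_cons, ih]; ring

lemma lap_const_mul (c : ℝ) (f : α → List α → ℝ) (l : List α) :
    lap (fun e t => c * f e t) l = c * lap f l := by
  induction l generalizing f with
  | nil => simp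
  | cons a l ih => rw [lap_cons, lap_cons, ih]; ring

lemma lap_neg (f : α → List α → ℝ) (l : List α) :
    lap (fun e t => -f e t) l = -lap f l := by
  simpa only [neg_one_mul] using lap_const_mul (-1) f l

lemma lap_sub (f g : α → List α → ℝ) (l : List α) :
    lap (fun e t => f e t - g e t) l = lap f l - lap g l := by
  simp only [sub_eq_add_neg, lap_add, lap_neg]

lemma lap_eq_zero {f : α → List α → ℝ} {l : List α}
    (h : ∀ e t, (e :: t).Perm l → f e t = 0) : lap f l = 0 := by
  rw [lap_congr (g := fun e t => 0 * f e t) (fun e t hp => by rw [h e t hp]; ring),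
    lap_const_mul, zero_mul]

lemma lap_map (φ : α → γ) (f : γ → List γ → ℝ) (l : List α) :
    lap f (l.map φ) = lap (fun e t => f (φ e) (t.map φ)) l := by
  induction l generalizing f with
  | nil => rfl
  | cons a l ih => rw [List.map_cons, lap_cons, lap_cons, ih]; rfl

lemma lap_append (f : α → List α → ℝ) (l₁ l₂ : List α) :
    lap f (l₁ ++ l₂) = lap (fun e t => f e (t ++ l₂)) l₁
      + (-1) ^ l₁.length * lap (fun e t => f e (l₁ ++ t)) l₂ := by
  induction l₁ generalizing f with
  | nil => simp
  | cons a l₁ ih =>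
    rw [List.cons_append, lap_cons, lap_cons, ih, List.length_cons, pow_succ]
    simp only [List.cons_append]
    ring

/-- Removing the same two entries in the opposite order changes the sign once. -/
lemma lap_lap_swap (h : α → α → List α → ℝ) (l : List α) :
    lap (fun e t => lap (fun e' t' => h e e' t') t) l
      = -lap (fun e t => lap (fun e' t' => h e' e t') t) l := by
  induction l generalizing h with
  | nil => simp
  | cons a l ih =>
    simp only [lap_cons, lap_sub]
    rw [ih (fun e e' t => h e e' (a :: t))]
    ring

lemma abs_lap_le {f : α → List α → ℝ} {l : List α} {D : ℝ}
    (h : ∀ e t, (e :: t).Perm l → |f e t| ≤ D) : |lap f l| ≤ l.length * D := by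
  induction l generalizing f with
  | nil => simp
  | cons a l ih =>
    rw [lap_cons]
    have h1 := h a l (List.Perm.refl _)
    have h2 : |lap (fun b t => f b (a :: t)) l| ≤ l.length * D :=
      ih fun e t hp => h e (a :: t) ((List.Perm.swap a e t).trans (hp.cons a))
    have h3 := abs_sub (f a l) (lap (fun b t => f b (a :: t)) l)
    rw [List.length_cons]
    push_cast
    linarith

lemma hasSum_lap {β : Type*} {f : β → α → List α → ℝ} {g : α → List α → ℝ} {l : List α}
    (h : ∀ e t, (e :: t).Perm l → HasSum (fun v => f v e t) (g e t)) :
    HasSum (fun v => lap (f v) l) (lap g l) := by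
  induction l generalizing f g with
  | nil => simp [hasSum_zero]
  | cons a l ih =>
    simp only [lap_cons]
    exact (h a l (List.Perm.refl _)).sub
      (ih fun e t hp => h e (a :: t) ((List.Perm.swap a e t).trans (hp.cons a)))

/-- Functions of a list that change sign when two neighbours are exchanged. -/
def Alternates (F : List α → ℝ) : Prop :=
  ∀ l₁ a b l₂, F (l₁ ++ a :: b :: l₂) = -F (l₁ ++ b :: a :: l₂)

lemma Alternates.cons {F : List α → ℝ} (hF : Alternates F) (c : α) :
    Alternates fun l => F (c :: l) :=
  fun l₁ a b l₂ => hF (c :: l₁) a b l₂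

lemma Alternates.prepend {F : List α → ℝ} (hF : Alternates F) (l : List α) :
    Alternates fun t => F (l ++ t) := by
  intro l₁ a b l₂
  have := hF (l ++ l₁) a b l₂
  simpa using this

/-- Moving the removed entry to the front of `F` costs exactly the sign it carries in `lap`. This
turns a product of two alternating factors into an unsigned sum, whose terms can be integrated
separately. -/
lemma Alternates.mul_lap {F : List α → ℝ} (hF : Alternates F) (h : α → List α → ℝ)
    (l : List α) : F l * lap h l = splitSum (fun v t => F (v :: t) * h v t) l := by
  induction l generalizing F h with
  | nil => simp [splitSum]
  | cons a l ih =>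
    have hs : (fun b t => F (b :: a :: t) * h b (a :: t))
        = fun b t => -(F (a :: b :: t)) * h b (a :: t) := by
      funext b t
      have := hF [] b a t
      simp only [List.nil_append] at this
      rw [this]
    have hneg : Alternates fun l => -F (a :: l) := fun l₁ x y l₂ => by
      have := hF.cons a l₁ x y l₂
      simp only at this ⊢
      rw [this]
    rw [splitSum, lap_cons, hs, ← ih hneg]
    ring

lemma Alternates.move_left {F : List α → ℝ} (hF : Alternates F) (l₁ : List α) (c : α)
    (l₂ : List α) : F (l₁ ++ c :: l₂) = (-1) ^ l₁.length * F (c :: (l₁ ++ l₂)) := by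
  induction l₁ generalizing F with
  | nil => simp
  | cons a l₁ ih =>
    have h := hF [] a c (l₁ ++ l₂)
    simp only [List.nil_append] at h
    rw [List.cons_append, ih (hF.cons a), h, List.length_cons, pow_succ, List.cons_append]
    ring

/-- An adjacent pair passes each entry with two sign changes. -/
lemma Alternates.move_pair {F : List α → ℝ} (hF : Alternates F) (a b : α)
    (l₁ l₂ r : List α) : F (l₁ ++ a :: b :: (l₂ ++ r)) = F (l₁ ++ (l₂ ++ a :: b :: r)) := by
  induction l₂ generalizing l₁ with
  | nil => rfl
  | cons c l₂ ih =>
    have h1 := hF (l₁ ++ [a]) b c (l₂ ++ r)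
    have h2 := hF l₁ a c (b :: (l₂ ++ r))
    have h3 := ih (l₁ ++ [c])
    simp only [List.append_assoc, List.cons_append, List.nil_append] at h1 h2 h3 ⊢
    rw [h1, h2, neg_neg, h3]

/-- Putting the removed entry back in its place cancels its sign, so all terms are equal. -/
lemma Alternates.lap_reverse_append {F : List α → ℝ} (hF : Alternates F) (l r : List α) :
    lap (fun e t => F (t.reverse ++ e :: r)) l = l.length * F (l.reverse ++ r) := by
  induction l generalizing r with
  | nil => simp
  | cons a l ih =>
    have h : (fun e t => F ((a :: t).reverse ++ e :: r))
        = fun e t => -F (t.reverse ++ e :: a :: r) := by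
      funext e t
      have := hF t.reverse a e r
      simpa using this
    rw [lap_cons, h, lap_neg, ih]
    simp only [List.reverse_cons, List.append_assoc, List.cons_append, List.nil_append,
      List.length_cons]
    push_cast
    ring

lemma Alternates.lap_cons_eq {F : List α → ℝ} (hF : Alternates F) (l : List α) :
    lap (fun e t => F (e :: t)) l = l.length * F l := by
  induction l generalizing F with
  | nil => simp
  | cons a l ih =>
    have h : (fun e t => F (e :: a :: t)) = fun e t => -F (a :: e :: t) := by
      funext e t
      exact hF [] e a t
    rw [lap_cons, h, lap_neg, ih (hF.cons a), List.length_cons]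
    push_cast
    ring

lemma Alternates.reverse_append {F : List α → ℝ} (hF : Alternates F) (l r : List α) :
    F (l.reverse ++ r) = (-1) ^ (l.length * (l.length - 1) / 2) * F (l ++ r) := by
  induction l generalizing r with
  | nil => simp
  | cons a l ih =>
    have h1 : (l.length + 1) * (l.length + 1 - 1) / 2
        = l.length + l.length * (l.length - 1) / 2 := by
      rw [← Finset.sum_range_id_mul_two, ← Finset.sum_range_id_mul_two, Finset.sum_range_succ]
      simp
      omega
    rw [List.reverse_cons, List.append_assoc, List.cons_append, List.nil_append, ih,
      hF.move_left, List.length_cons, h1, pow_add, List.cons_append]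
    ring

/-- Auxiliary recursion for `pf`, with a bound on the depth. -/
def pfAux (A : α → α → ℝ) : ℕ → List α → ℝ
  | _, [] => 1
  | 0, _ :: _ => 0
  | n + 1, c :: l => lap (fun b t => A c b * pfAux A n t) l

/-- The Pfaffian of the matrix `A (l i) (l j)`, by expansion along the first row. -/
def pf (A : α → α → ℝ) (l : List α) : ℝ := pfAux A l.length l

/-- Any depth at least the length gives the same value; this makes the row expansion `pf_cons` free
of the depth. -/
lemma pfAux_eq (A : α → α → ℝ) (n : ℕ) (l : List α) (h : l.length ≤ n) :
    pfAux A n l = pf A l := by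
  suffices H : ∀ N n n' (l : List α), l.length ≤ N → l.length ≤ n → l.length ≤ n' →
      pfAux A n l = pfAux A n' l from H n n l.length l h h le_rfl
  intro N
  induction N with
  | zero =>
    intro n n' l h0 _ _
    obtain rfl : l = [] := List.length_eq_zero_iff.1 (by omega)
    cases n <;> cases n' <;> rfl
  | succ N ih =>
    intro n n' l h0 h1 h2
    cases l with
    | nil => cases n <;> cases n' <;> rfl
    | cons c l =>
      simp only [List.length_cons] at h0 h1 h2
      obtain ⟨n, rfl⟩ : ∃ k, n = k + 1 := ⟨n - 1, by omega⟩
      obtain ⟨n', rfl⟩ : ∃ k, n' = k + 1 := ⟨n' - 1, by omega⟩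
      simp only [pfAux]
      apply lap_congr
      intro e t hp
      have := hp.length_eq
      simp only [List.length_cons] at this
      rw [ih n n' t (by omega) (by omega) (by omega)]

@[simp] lemma pf_nil (A : α → α → ℝ) : pf A [] = 1 := rfl

lemma pf_cons (A : α → α → ℝ) (c : α) (l : List α) :
    pf A (c :: l) = lap (fun b t => A c b * pf A t) l := by
  rw [pf, List.length_cons, pfAux]
  apply lap_congr
  intro e t hp
  have := hp.length_eq
  simp only [List.length_cons] at this
  rw [pfAux_eq A _ t (by omega)]

lemma pf_map (A : γ → γ → ℝ) (φ : α → γ) (l : List α) :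
    pf A (l.map φ) = pf (fun x y => A (φ x) (φ y)) l := by
  generalize hn : l.length = n
  induction n using Nat.strong_induction_on generalizing l with
  | _ n ih =>
    cases l with
    | nil => rfl
    | cons c l =>
      rw [List.map_cons, pf_cons, pf_cons, lap_map]
      apply lap_congr
      intro e t hp
      have := hp.length_eq
      simp only [List.length_cons] at this hn
      rw [ih t.length (by omega) t rfl]

/-- If the pair is in front, expand along both rows and use `lap_lap_swap`; otherwise expand along
the first row and induct. -/
lemma pf_alternates (A : α → α → ℝ) (hA : ∀ x y, A x y = -A y x) : Alternates (pf A) := by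
  suffices H : ∀ n l₁ a b l₂, l₁.length + l₂.length < n →
      pf A (l₁ ++ a :: b :: l₂) = -pf A (l₁ ++ b :: a :: l₂) from
    fun l₁ a b l₂ => H _ l₁ a b l₂ (Nat.lt_succ_self _)
  intro n
  induction n with
  | zero => intro l₁ a b l₂ h; omega
  | succ n ih =>
    intro l₁ a b l₂ h
    cases l₁ with
    | nil =>
      simp only [List.nil_append, pf_cons, lap_cons, ← lap_const_mul]
      rw [lap_lap_swap, hA a b]
      have : (fun e t => lap (fun e' t' => A a e' * (A b e * pf A t')) t)
          = fun e t => lap (fun e' t' => A b e * (A a e' * pf A t')) t := by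
        funext e t
        congr 1
        funext e' t'
        ring
      rw [this]
      ring
    | cons c l₁ =>
      simp only [List.length_cons] at h
      have e1 : lap (fun e t => A c e * pf A (t ++ a :: b :: l₂)) l₁
          = -lap (fun e t => A c e * pf A (t ++ b :: a :: l₂)) l₁ := by
        rw [← lap_neg]
        apply lap_congr
        intro e t hp
        have := hp.length_eq
        simp only [List.length_cons] at this
        rw [ih t a b l₂ (by omega)]
        ring
      have e2 : lap (fun e t => A c e * pf A (l₁ ++ a :: b :: t)) l₂
          = -lap (fun e t => A c e * pf A (l₁ ++ b :: a :: t)) l₂ := by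
        rw [← lap_neg]
        apply lap_congr
        intro e t hp
        have := hp.length_eq
        simp only [List.length_cons] at this
        rw [ih l₁ a b t (by omega)]
        ring
      simp only [List.cons_append, pf_cons, lap_append, lap_cons]
      rw [e1, e2]
      ring

/-- Expansion along an inner row. With the left part reversed, the position of an entry is its
distance from `c` on either side, so both sums have the signs of `lap`. -/
lemma pf_reverse_append_cons (A : α → α → ℝ) (hA : ∀ x y, A x y = -A y x) (l : List α) (c : α)
    (r : List α) : pf A (l.reverse ++ c :: r)
      = lap (fun e t => A c e * pf A (l.reverse ++ t)) r
        - lap (fun e t => A c e * pf A (t.reverse ++ r)) l := by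
  induction l generalizing r with
  | nil => simp [pf_cons]
  | cons a l ih =>
    have h := pf_alternates A hA l.reverse a c r
    simp only [List.reverse_cons, List.append_assoc, List.cons_append, List.nil_append] at h ⊢
    rw [h, ih (a :: r)]
    simp only [lap_cons, List.reverse_cons, List.append_assoc, List.cons_append,
      List.nil_append]
    ring

lemma pf_eq_zero_of_odd (A : α → α → ℝ) (l : List α) (h : Odd l.length) : pf A l = 0 := by
  generalize hn : l.length = n at h
  induction n using Nat.strong_induction_on generalizing l with
  | _ n ih =>
    cases l with
    | nil => subst hn; simp at h
    | cons c l =>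
      rw [pf_cons]
      apply lap_eq_zero
      intro e t hp
      have := hp.length_eq
      simp only [List.length_cons] at this hn
      rw [ih t.length (by omega) t rfl (by
        obtain ⟨r, hr⟩ := h
        exact ⟨r - 1, by omega⟩), mul_zero]

lemma pf_neg (A : α → α → ℝ) (l : List α) :
    pf (fun x y => -A x y) l = (-1) ^ (l.length / 2) * pf A l := by
  generalize hn : l.length = n
  induction n using Nat.strong_induction_on generalizing l with
  | _ n ih =>
    cases l with
    | nil => subst hn; simp
    | cons c l =>
      rw [pf_cons, pf_cons, ← lap_const_mul]
      apply lap_congr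
      intro e t hp
      have := hp.length_eq
      simp only [List.length_cons] at this hn
      have h2 : n / 2 = t.length / 2 + 1 := by omega
      rw [ih t.length (by omega) t rfl, h2, pow_succ]
      ring

/-- For length 2k, transposing the matrix and reversing the list each contribute (-1)^k. -/
lemma pf_flip_reverse (A : α → α → ℝ) (hA : ∀ x y, A x y = -A y x) (l : List α) :
    pf (fun x y => A y x) l.reverse = pf A l := by
  have h0 : (fun x y => A y x) = fun x y => -A x y := by
    funext x y
    exact hA y x
  rw [h0, pf_neg, List.length_reverse]
  have h1 := (pf_alternates A hA).reverse_append l []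
  simp only [List.append_nil] at h1
  rw [h1]
  rcases Nat.even_or_odd' l.length with ⟨k, hk | hk⟩
  · rw [hk]
    rcases Nat.eq_zero_or_pos k with rfl | hk0
    · simp
    · have e1 : 2 * k / 2 = k := by omega
      have e2 : 2 * k * (2 * k - 1) / 2 = k * (2 * k - 1) := by
        rw [mul_assoc]; omega
      have e3 : Odd (2 * k - 1) := ⟨k - 1, by omega⟩
      rw [e1, e2, mul_comm k, pow_mul, e3.neg_one_pow, ← mul_assoc, ← pow_add]
      simp
  · rw [pf_eq_zero_of_odd A l ⟨k, hk⟩]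
    simp

/-- Every term of a Pfaffian contains each index once, so the product of `h` comes out. The number
of terms is estimated crudely by a factorial. -/
lemma abs_pf_le (A : α → α → ℝ) (h : α → ℝ) (h0 : ∀ x, 0 ≤ h x)
    (hA : ∀ x y, |A x y| ≤ h x * h y) (l : List α) :
    |pf A l| ≤ l.length.factorial * (l.map h).prod := by
  generalize hn : l.length = n
  induction n using Nat.strong_induction_on generalizing l with
  | _ n ih =>
    cases l with
    | nil => subst hn; simp
    | cons c l =>
      simp only [List.length_cons] at hn
      obtain rfl | ⟨k, hk⟩ : l = [] ∨ ∃ k, l.length = k + 1 := by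
        cases l with
        | nil => exact Or.inl rfl
        | cons a l => exact Or.inr ⟨l.length, rfl⟩
      · rw [pf_cons]
        simp only [lap_nil, abs_zero, List.map_cons, List.map_nil, List.prod_cons,
          List.prod_nil, mul_one]
        exact mul_nonneg (Nat.cast_nonneg _) (h0 c)
      · have hl : ∀ l : List α, 0 ≤ (l.map h).prod := by
          intro l
          apply List.prod_nonneg
          intro a ha
          obtain ⟨x, -, rfl⟩ := List.mem_map.1 ha
          exact h0 x
        have hb : |pf A (c :: l)| ≤ l.length * (k.factorial * (h c * (l.map h).prod)) := by
          rw [pf_cons]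
          apply abs_lap_le
          intro e t hp
          have hlen := hp.length_eq
          simp only [List.length_cons] at hlen
          have ht := ih t.length (by omega) t rfl
          have hprod : (l.map h).prod = h e * (t.map h).prod := by
            rw [← (hp.map h).prod_eq, List.map_cons, List.prod_cons]
          have hk' : t.length = k := by omega
          rw [hk'] at ht
          rw [abs_mul, hprod]
          calc |A c e| * |pf A t| ≤ (h c * h e) * (k.factorial * (t.map h).prod) :=
                mul_le_mul (hA c e) ht (abs_nonneg _) (mul_nonneg (h0 c) (h0 e))
            _ = _ := by ring
        refine hb.trans ?_
        have hn' : n = k + 1 + 1 := by omega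
        rw [hk, hn', List.map_cons, List.prod_cons, ← mul_assoc]
        have h1 : ((k + 1 : ℕ) : ℝ) * (k.factorial : ℝ) ≤ ((k + 1 + 1).factorial : ℝ) := by
          rw [← Nat.cast_mul, ← Nat.factorial_succ]
          exact_mod_cast Nat.factorial_le (by omega)
        exact mul_le_mul_of_nonneg_right h1 (mul_nonneg (h0 c) (hl l))

end ListPfaffian

/-! ### Comparison of the permutation sum with the row expansion. -/

section PermutationSum

variable {α : Type*}

lemma lap_ofFn {n : ℕ} (f : α → List α → ℝ) (v : Fin (n + 1) → α) :
    lap f (List.ofFn v)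
      = ∑ p : Fin (n + 1), (-1) ^ (p : ℕ) * f (v p) (List.ofFn fun i => v (p.succAbove i)) := by
  induction n generalizing f with
  | zero => simp [lap_cons]
  | succ n ih =>
    rw [List.ofFn_succ, lap_cons, ih, Fin.sum_univ_succ (n := n + 1), sub_eq_add_neg, ← Finset.sum_neg_distrib]
    congr 1
    · simp
    · apply Finset.sum_congr rfl
      intro p _
      rw [List.ofFn_succ (f := fun i => v (p.succ.succAbove i))]
      simp only [Fin.succ_succAbove_zero, Fin.succ_succAbove_succ, Fin.val_succ, pow_succ]
      ring

lemma splitSum_ofFn {n : ℕ} (f : α → List α → ℝ) (v : Fin (n + 1) → α) :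
    splitSum f (List.ofFn v)
      = ∑ p : Fin (n + 1), f (v p) (List.ofFn fun i => v (p.succAbove i)) := by
  induction n generalizing f with
  | zero => simp [splitSum]
  | succ n ih =>
    rw [List.ofFn_succ, splitSum, ih, Fin.sum_univ_succ (n := n + 1)]
    congr 1
    apply Finset.sum_congr rfl
    intro p _
    rw [List.ofFn_succ (f := fun i => v (p.succ.succAbove i))]
    simp only [Fin.succ_succAbove_zero, Fin.succ_succAbove_succ]

/-- The permutation that maps `0` to `p` and `i + 1` to `p.succAbove (e i)`. -/
def consPerm {n : ℕ} (x : Fin (n + 1) × Equiv.Perm (Fin n)) : Equiv.Perm (Fin (n + 1)) :=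
  (Fin.cycleRange x.1).symm * Equiv.Perm.decomposeFin.symm (0, x.2)

lemma consPerm_zero {n : ℕ} (p : Fin (n + 1)) (e : Equiv.Perm (Fin n)) :
    consPerm (p, e) 0 = p := by
  simp [consPerm]

lemma consPerm_succ {n : ℕ} (p : Fin (n + 1)) (e : Equiv.Perm (Fin n)) (i : Fin n) :
    consPerm (p, e) i.succ = p.succAbove (e i) := by
  simp [consPerm]

lemma sign_consPerm {n : ℕ} (p : Fin (n + 1)) (e : Equiv.Perm (Fin n)) :
    ((Equiv.Perm.sign (consPerm (p, e)) : ℤ) : ℝ)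
      = (-1) ^ (p : ℕ) * ((Equiv.Perm.sign e : ℤ) : ℝ) := by
  rw [consPerm, Equiv.Perm.sign_mul, Equiv.Perm.sign_symm, Fin.sign_cycleRange,
    Equiv.Perm.decomposeFin.symm_sign]
  simp

lemma consPerm_bijective (n : ℕ) : Function.Bijective (consPerm (n := n)) := by
  rw [Fintype.bijective_iff_injective_and_card]
  refine ⟨?_, (Fintype.card_congr Equiv.Perm.decomposeFin).symm⟩
  rintro ⟨p, e⟩ ⟨p', e'⟩ h
  have h0 : p = p' := by rw [← consPerm_zero p e, h, consPerm_zero]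
  subst h0
  have h1 : e = e' := by
    ext i
    have := consPerm_succ p e i
    rw [h, consPerm_succ] at this
    rw [p.succAbove_right_injective this]
  rw [h1]

lemma sum_perm_eq_sum_consPerm {n : ℕ} (F : Equiv.Perm (Fin (n + 1)) → ℝ) :
    ∑ σ, F σ = ∑ p, ∑ e, F (consPerm (p, e)) := by
  rw [← Fintype.sum_prod_type (f := fun x => F (consPerm x))]
  exact ((consPerm_bijective n).sum_comp F).symm

/-- Splitting off the images of 0 and 1 reduces m + 1 to m. The sum over the image of 1 is the
expansion along a first row. -/
lemma sum_perm_pairs_eq_pf (A : α → α → ℝ) (hA : ∀ x y, A x y = -A y x) (m : ℕ)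
    (v : Fin (2 * m) → α) :
    ∑ σ : Equiv.Perm (Fin (2 * m)), ((Equiv.Perm.sign σ : ℤ) : ℝ) *
      ∏ i : Fin m, A (v (σ ⟨2 * i.1, by omega⟩)) (v (σ ⟨2 * i.1 + 1, by omega⟩))
      = 2 ^ m * (m.factorial : ℝ) * pf A (List.ofFn v) := by
  induction m with
  | zero => simp
  | succ m ih =>
    have step : ∀ (p : Fin (2 * m + 1 + 1)) (j : Fin (2 * m + 1)) (e : Equiv.Perm (Fin (2 * m))),
        ((Equiv.Perm.sign (consPerm (p, consPerm (j, e))) : ℤ) : ℝ) *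
          ∏ i : Fin (m + 1), A (v (consPerm (p, consPerm (j, e)) ⟨2 * i.1, by omega⟩))
            (v (consPerm (p, consPerm (j, e)) ⟨2 * i.1 + 1, by omega⟩))
        = ((-1) ^ (p : ℕ) * ((-1) ^ (j : ℕ) * A (v p) (v (p.succAbove j)))) *
          (((Equiv.Perm.sign e : ℤ) : ℝ) *
          ∏ i : Fin m, A (v (p.succAbove (j.succAbove (e ⟨2 * i.1, by omega⟩))))
            (v (p.succAbove (j.succAbove (e ⟨2 * i.1 + 1, by omega⟩))))) := by
      intro p j e
      have h0 : consPerm (p, consPerm (j, e)) (0 : Fin (2 * m + 1 + 1)) = p := consPerm_zero _ _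
      have h1 : consPerm (p, consPerm (j, e)) (Fin.succ (0 : Fin (2 * m + 1))) = p.succAbove j := by
        rw [consPerm_succ, consPerm_zero]
      have h2 : ∀ i : Fin (2 * m), consPerm (p, consPerm (j, e)) i.succ.succ
          = p.succAbove (j.succAbove (e i)) := by
        intro i
        rw [consPerm_succ, consPerm_succ]
      rw [sign_consPerm, sign_consPerm, Fin.prod_univ_succ]
      have e0 : A (v (consPerm (p, consPerm (j, e)) ⟨2 * (0 : Fin (m + 1)).1, by simp⟩))
            (v (consPerm (p, consPerm (j, e)) ⟨2 * (0 : Fin (m + 1)).1 + 1, by simp⟩))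
          = A (v p) (v (p.succAbove j)) := by
        change A (v (consPerm (p, consPerm (j, e)) (0 : Fin (2 * m + 1 + 1))))
          (v (consPerm (p, consPerm (j, e)) (Fin.succ (0 : Fin (2 * m + 1))))) = _
        rw [h1, h0]
      have e1 : ∀ i : Fin m,
          A (v (consPerm (p, consPerm (j, e)) ⟨2 * i.succ.1, by omega⟩))
            (v (consPerm (p, consPerm (j, e)) ⟨2 * i.succ.1 + 1, by omega⟩))
          = A (v (p.succAbove (j.succAbove (e ⟨2 * i.1, by omega⟩))))
            (v (p.succAbove (j.succAbove (e ⟨2 * i.1 + 1, by omega⟩)))) := by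
        intro i
        rw [← h2, ← h2]
        rfl
      rw [e0, Finset.prod_congr rfl fun i _ => e1 i]
      ring
    have key : ∀ p : Fin (2 * m + 1 + 1),
        pf A (v p :: List.ofFn fun i => v (p.succAbove i))
          = ∑ j : Fin (2 * m + 1), (-1) ^ (j : ℕ) * (A (v p) (v (p.succAbove j)) *
              pf A (List.ofFn fun i => v (p.succAbove (j.succAbove i)))) := by
      intro p
      rw [pf_cons, lap_ofFn]
    -- The sum over the image of 0 repeats the same Pfaffian 2(m+1) times, which is the ratio of the
    -- normalizing constants.
    have tot := (pf_alternates A hA).lap_cons_eq (List.ofFn v)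
    rw [show List.ofFn v = List.ofFn (n := 2 * m + 1 + 1) v from rfl, lap_ofFn] at tot
    calc _ = ∑ p : Fin (2 * m + 1 + 1), ∑ j : Fin (2 * m + 1), ∑ e : Equiv.Perm (Fin (2 * m)),
          ((-1) ^ (p : ℕ) * ((-1) ^ (j : ℕ) * A (v p) (v (p.succAbove j)))) *
          (((Equiv.Perm.sign e : ℤ) : ℝ) *
          ∏ i : Fin m, A (v (p.succAbove (j.succAbove (e ⟨2 * i.1, by omega⟩))))
            (v (p.succAbove (j.succAbove (e ⟨2 * i.1 + 1, by omega⟩))))) := by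
          refine (sum_perm_eq_sum_consPerm (n := 2 * m + 1) _).trans ?_
          refine Finset.sum_congr rfl fun p _ => ?_
          refine (sum_perm_eq_sum_consPerm (n := 2 * m) _).trans ?_
          exact Finset.sum_congr rfl fun j _ => Finset.sum_congr rfl fun e _ => step p j e
      _ = 2 ^ m * (m.factorial : ℝ) * ∑ p : Fin (2 * m + 1 + 1), (-1) ^ (p : ℕ) *
            pf A (v p :: List.ofFn fun i => v (p.succAbove i)) := by
          rw [Finset.mul_sum]
          refine Finset.sum_congr rfl fun p _ => ?_
          rw [key, Finset.mul_sum, Finset.mul_sum]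
          refine Finset.sum_congr rfl fun j _ => ?_
          rw [← Finset.mul_sum, ih fun i => v (p.succAbove (j.succAbove i))]
          ring
      _ = _ := by
          refine (congrArg _ tot).trans ?_
          rw [List.length_ofFn, Nat.factorial_succ]
          push_cast
          ring

lemma pfaffian_eq_pf (A : α → α → ℝ) (hA : ∀ x y, A x y = -A y x) {m : ℕ}
    (v : Fin (2 * m) → α) : pfaffian (fun i j => A (v i) (v j)) = pf A (List.ofFn v) := by
  unfold pfaffian
  rw [sum_perm_pairs_eq_pf A hA]
  have : (2 : ℝ) ^ m * (m.factorial : ℝ) ≠ 0 := by positivity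
  field_simp

end PermutationSum

/-! ### Pfaffians of Gram matrices of a symplectic form as determinants. -/

section SymplecticForm

variable {α : Type*}

/-- The skew symmetric form `∑ k < m, (α (2k) β (2k+1) - α (2k+1) β (2k)) / u k`. -/
noncomputable def symp (m : ℕ) (u : ℕ → ℝ) (α β : ℕ → ℝ) : ℝ :=
  ∑ k ∈ Finset.range m, (1 / u k) * (α (2 * k) * β (2 * k + 1) - α (2 * k + 1) * β (2 * k))

lemma symp_swap (m : ℕ) (u α β : ℕ → ℝ) : symp m u α β = -symp m u β α := by
  rw [symp, symp, ← Finset.sum_neg_distrib]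
  exact Finset.sum_congr rfl fun k _ => by ring

lemma symp_congr {m : ℕ} {u α α' β β' : ℕ → ℝ} (hα : ∀ k < 2 * m, α k = α' k)
    (hβ : ∀ k < 2 * m, β k = β' k) : symp m u α β = symp m u α' β' := by
  refine Finset.sum_congr rfl fun k hk => ?_
  have := Finset.mem_range.1 hk
  rw [hα _ (by omega), hα _ (by omega), hβ _ (by omega), hβ _ (by omega)]

lemma hasSum_symp_left {ι : Type*} {m : ℕ} {u : ℕ → ℝ} {r : ι → ℝ} {α : ι → ℕ → ℝ}
    {α' : ℕ → ℝ} (h : ∀ k < 2 * m, HasSum (fun v => r v * α v k) (α' k)) (β : ℕ → ℝ) :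
    HasSum (fun v => r v * symp m u (α v) β) (symp m u α' β) := by
  have : ∀ v, r v * symp m u (α v) β = ∑ k ∈ Finset.range m,
      (1 / u k) * (r v * α v (2 * k) * β (2 * k + 1) - r v * α v (2 * k + 1) * β (2 * k)) := by
    intro v
    rw [symp, Finset.mul_sum]
    exact Finset.sum_congr rfl fun k _ => by ring
  simp only [this]
  refine hasSum_sum fun k hk => ?_
  have hk := Finset.mem_range.1 hk
  exact (((h (2 * k) (by omega)).mul_right _).sub
    ((h (2 * k + 1) (by omega)).mul_right _)).mul_left _

lemma symp_single_even (m : ℕ) (u β : ℕ → ℝ) (a : ℕ) (ha : a < m) :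
    symp m u (Pi.single (2 * a) 1) β = 1 / u a * β (2 * a + 1) := by
  rw [symp, Finset.sum_eq_single a]
  · have : (Pi.single (2 * a) 1 : ℕ → ℝ) (2 * a + 1) = 0 := Pi.single_eq_of_ne (by omega) _
    rw [this, Pi.single_eq_same]
    ring
  · intro k _ hk
    have h1 : (Pi.single (2 * a) 1 : ℕ → ℝ) (2 * k + 1) = 0 := Pi.single_eq_of_ne (by omega) _
    have h2 : (Pi.single (2 * a) 1 : ℕ → ℝ) (2 * k) = 0 := Pi.single_eq_of_ne (by omega) _
    rw [h1, h2]
    ring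
  · intro h
    exact absurd (Finset.mem_range.2 ha) h

/-- On unit vectors the Gram matrix is block diagonal with 2 × 2 blocks; the list starts at the even
index 2a so that a block can be split off. -/
lemma pf_symp_single (m : ℕ) (u : ℕ → ℝ) (c a : ℕ) (h : a + c = m) :
    pf (fun i j : ℕ => symp m u (Pi.single i 1) (Pi.single j 1)) (List.range' (2 * a) (2 * c))
      = ∏ k ∈ Finset.Ico a m, (1 / u k) := by
  induction c generalizing a with
  | zero => subst h; simp
  | succ c ih =>
    have e1 : List.range' (2 * a) (2 * (c + 1))
        = 2 * a :: (2 * a + 1) :: List.range' (2 * (a + 1)) (2 * c) := rfl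
    rw [e1, pf_cons, lap_cons, ih (a + 1) (by omega), lap_eq_zero,
      Finset.prod_eq_prod_Ico_succ_bot (show a < m by omega), symp_single_even _ _ _ _ (by omega), Pi.single_eq_same]
    · ring
    · intro e t hp
      have he : e ∈ List.range' (2 * (a + 1)) (2 * c) := hp.subset List.mem_cons_self
      have : 2 * (a + 1) ≤ e := (List.mem_range'_1.1 he).1
      rw [symp_single_even _ _ _ _ (by omega), Pi.single_eq_of_ne (by omega)]
      ring

/-- For even length, composing with the transposition of `i` and `j` negates the permutation sum
without changing its products. For odd length every Pfaffian is zero. -/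
lemma pf_ofFn_eq_zero_of_eq (A : α → α → ℝ) (hA : ∀ x y, A x y = -A y x) {n : ℕ}
    (v : Fin n → α) (i j : Fin n) (hv : v i = v j) (hij : i ≠ j) : pf A (List.ofFn v) = 0 := by
  rcases Nat.even_or_odd' n with ⟨m, rfl | rfl⟩
  · have hS := sum_perm_pairs_eq_pf A hA m v
    have hsw : ∀ k, v (Equiv.swap i j k) = v k := by
      intro k
      rcases eq_or_ne k i with rfl | hi
      · rw [Equiv.swap_apply_left, hv]
      · rcases eq_or_ne k j with rfl | hj
        · rw [Equiv.swap_apply_right, hv]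
        · rw [Equiv.swap_apply_of_ne_of_ne hi hj]
    have hneg := Equiv.sum_comp (Equiv.mulLeft (Equiv.swap i j))
      (fun σ : Equiv.Perm (Fin (2 * m)) => ((Equiv.Perm.sign σ : ℤ) : ℝ) *
      ∏ i : Fin m, A (v (σ ⟨2 * i.1, by omega⟩)) (v (σ ⟨2 * i.1 + 1, by omega⟩)))
    simp only [Equiv.coe_mulLeft, Equiv.Perm.sign_mul, Equiv.Perm.sign_swap hij,
      Equiv.Perm.mul_apply, hsw] at hneg
    rw [hS] at hneg
    have h2 : (2 : ℝ) ^ m * (m.factorial : ℝ) ≠ 0 := by positivity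
    simp only [neg_mul, one_mul, Units.val_neg, Int.cast_neg, Finset.sum_neg_distrib, hS] at hneg
    have h3 : (2 : ℝ) ^ m * (m.factorial : ℝ) * pf A (List.ofFn v) = 0 := by linarith
    exact (mul_eq_zero.1 h3).resolve_left h2
  · exact pf_eq_zero_of_odd A _ ⟨m, by simp⟩

lemma ofFn_update {n : ℕ} (v : Fin n → α) (i : Fin n) (x : α) :
    List.ofFn (Function.update v i x)
      = (List.ofFn v).take i ++ x :: (List.ofFn v).drop (i + 1) := by
  have h := List.set_eq_take_append_cons_drop (l := List.ofFn v) (i := i) (a := x)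
  rw [if_pos (by simp)] at h
  rw [← h]
  apply List.ext_getElem
  · simp
  · intro k h1 h2
    simp only [List.getElem_ofFn, List.getElem_set, Function.update_apply, Fin.ext_iff]
    simp only [eq_comm]

variable {V : Type*} [AddCommGroup V] [Module ℝ V]

/-- The Pfaffian of the Gram matrix of a skew symmetric bilinear form, as an alternating map. -/
def pfAlternating (B : V →ₗ[ℝ] V →ₗ[ℝ] ℝ) (hB : ∀ x y, B x y = -B y x) (n : ℕ) :
    V [⋀^Fin n]→ₗ[ℝ] ℝ where
  toFun v := pf (fun x y => B x y) (List.ofFn v)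
  map_update_add' := by
    intro inst v i x y
    obtain rfl : inst = instDecidableEqFin n := Subsingleton.elim _ _
    simp only [ofFn_update, (pf_alternates _ hB).move_left, pf_cons, map_add,
      LinearMap.add_apply, add_mul, lap_add, mul_add]
  map_update_smul' := by
    intro inst v i c x
    obtain rfl : inst = instDecidableEqFin n := Subsingleton.elim _ _
    simp only [ofFn_update, (pf_alternates _ hB).move_left, pf_cons, map_smul,
      LinearMap.smul_apply, smul_eq_mul, mul_assoc, lap_const_mul]
    ring
  map_eq_zero_of_eq' := fun v i j hv hij => pf_ofFn_eq_zero_of_eq _ hB v i j hv hij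

/-- Extension of a finite sequence by zero. -/
def extendZero (n : ℕ) : (Fin n → ℝ) →ₗ[ℝ] (ℕ → ℝ) where
  toFun α k := if h : k < n then α ⟨k, h⟩ else 0
  map_add' α β := by
    funext k
    by_cases h : k < n <;> simp [h]
  map_smul' c α := by
    funext k
    by_cases h : k < n <;> simp [h]

lemma extendZero_apply {n k : ℕ} (α : Fin n → ℝ) (h : k < n) : extendZero n α k = α ⟨k, h⟩ := by
  simp [extendZero, h]

lemma extendZero_single {n : ℕ} (i : Fin n) :
    extendZero n (Pi.single i 1) = Pi.single (i : ℕ) 1 := by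
  funext k
  by_cases h : k < n
  · rw [extendZero_apply _ h]
    simp [Pi.single_apply, Fin.ext_iff]
  · have : k ≠ i := by omega
    simp [extendZero, h, this]

/-- `symp` as a bilinear form on finite sequences. -/
noncomputable def sympForm (m : ℕ) (u : ℕ → ℝ) :
    (Fin (2 * m) → ℝ) →ₗ[ℝ] (Fin (2 * m) → ℝ) →ₗ[ℝ] ℝ :=
  LinearMap.mk₂ ℝ (fun α β => symp m u (extendZero _ α) (extendZero _ β))
    (by
      intro α α' β
      simp only [symp, map_add, Pi.add_apply, ← Finset.sum_add_distrib]
      exact Finset.sum_congr rfl fun k _ => by ring)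
    (by
      intro c α β
      simp only [symp, map_smul, Pi.smul_apply, smul_eq_mul, Finset.mul_sum]
      exact Finset.sum_congr rfl fun k _ => by ring)
    (by
      intro α β β'
      simp only [symp, map_add, Pi.add_apply, ← Finset.sum_add_distrib]
      exact Finset.sum_congr rfl fun k _ => by ring)
    (by
      intro c α β
      simp only [symp, map_smul, Pi.smul_apply, smul_eq_mul, Finset.mul_sum]
      exact Finset.sum_congr rfl fun k _ => by ring)

lemma sympForm_apply (m : ℕ) (u : ℕ → ℝ) (α β : ℕ → ℝ) :
    sympForm m u (fun i => α i) (fun i => β i) = symp m u α β :=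
  symp_congr (fun _ hk => extendZero_apply _ hk) (fun _ hk => extendZero_apply _ hk)

lemma sympForm_swap (m : ℕ) (u : ℕ → ℝ) (α β : Fin (2 * m) → ℝ) :
    sympForm m u α β = -sympForm m u β α :=
  symp_swap _ _ _ _

lemma pf_symp_eq_pfAlternating (m : ℕ) (u : ℕ → ℝ) (ψ : ℕ → α → ℝ) {n : ℕ} (z : Fin n → α) :
    pf (fun x y => symp m u (fun k => ψ k x) (fun k => ψ k y)) (List.ofFn z)
      = pfAlternating (sympForm m u) (sympForm_swap m u) n (fun i j => ψ j (z i)) := by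
  have : List.ofFn (fun i => (fun j : Fin (2 * m) => ψ j (z i)))
      = (List.ofFn z).map fun x => fun j : Fin (2 * m) => ψ j x := by
    rw [List.map_ofFn]; rfl
  change _ = pf _ (List.ofFn _)
  rw [this, pf_map]
  congr 1
  funext x y
  exact (sympForm_apply m u (fun k => ψ k x) (fun k => ψ k y)).symm

/-- More than 2m vectors in a space of dimension 2m are dependent. -/
lemma pf_symp_eq_zero (m : ℕ) (u : ℕ → ℝ) (ψ : ℕ → α → ℝ) (l : List α) (hl : 2 * m < l.length) :
    pf (fun x y => symp m u (fun k => ψ k x) (fun k => ψ k y)) l = 0 := by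
  have h := pf_symp_eq_pfAlternating m u ψ l.get
  rw [List.ofFn_get] at h
  rw [h]
  apply AlternatingMap.map_linearDependent
  intro hli
  have := hli.fintype_card_le_finrank
  simp at this
  omega

/-- An alternating form of 2m vectors in dimension 2m is a multiple of the determinant, and its
value on the standard basis is the factor. -/
lemma pf_symp_eq_det (m : ℕ) (u : ℕ → ℝ) (ψ : ℕ → α → ℝ) (z : Fin (2 * m) → α) :
    pf (fun x y => symp m u (fun k => ψ k x) (fun k => ψ k y)) (List.ofFn z)
      = (∏ k ∈ Finset.range m, (1 / u k)) *
        (Matrix.of fun i j : Fin (2 * m) => ψ j (z i)).det := by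
  rw [pf_symp_eq_pfAlternating, AlternatingMap.eq_smul_basis_det (Pi.basisFun ℝ (Fin (2 * m)))
    (pfAlternating _ _ _), AlternatingMap.smul_apply, smul_eq_mul, Pi.basisFun_det]
  congr 1
  have h := pf_symp_single m u m 0 (zero_add m)
  rw [← Finset.range_eq_Ico] at h
  rw [← h]
  have e : List.range' (2 * 0) (2 * m) = List.ofFn (fun i : Fin (2 * m) => (i : ℕ)) := by
    apply List.ext_getElem <;> simp
  have e2 : List.ofFn (Pi.basisFun ℝ (Fin (2 * m)))
      = (List.ofFn id).map (fun i : Fin (2 * m) => (Pi.single i 1 : Fin (2 * m) → ℝ)) := by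
    rw [List.map_ofFn]
    congr 1
    funext i
    simp
  have e3 : List.ofFn (fun i : Fin (2 * m) => (i : ℕ)) = (List.ofFn (id : Fin (2 * m) → Fin (2 * m))).map Fin.val := by
    rw [List.map_ofFn]; rfl
  change pf _ (List.ofFn _) = _
  rw [e, e2, e3, pf_map, pf_map]
  congr 1
  funext i j
  change symp m u (extendZero _ _) (extendZero _ _) = _
  rw [extendZero_single, extendZero_single]

end SymplecticForm

/-! ### Absolutely convergent sums over configurations. -/

section MultiSums

variable {X : Type*}

lemma summable_prod_pi {f : X → ℝ} (h0 : ∀ x, 0 ≤ f x) (hf : Summable f) (m : ℕ) :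
    Summable fun w : Fin m → X => ∏ i, f (w i) := by
  induction m with
  | zero => exact Summable.of_finite
  | succ m ih =>
    rw [← (Fin.insertNthEquiv (fun _ => X) 0).summable_iff]
    have h := hf.mul_of_nonneg ih h0 fun w => Finset.prod_nonneg fun i _ => h0 (w i)
    refine h.congr fun p => ?_
    simp [Fin.prod_univ_succ, Fin.insertNthEquiv]

/-- The product of the weights of the points of a configuration. -/
def wprod (μ : X → ℝ) {m : ℕ} (w : Fin m → X) : ℝ := ∏ i, μ (w i)

lemma summable_of_le_prod {μ g : X → ℝ} (hg : Summable fun x => |μ x| * g x)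
    (hg0 : ∀ x, 0 ≤ g x) {m : ℕ} {f : List X → ℝ} {D : ℝ}
    (hf : ∀ l : List X, l.length = m → |f l| ≤ D * (l.map g).prod) :
    Summable fun w : Fin m → X => wprod μ w * f (List.ofFn w) := by
  have h := (summable_prod_pi (fun x => mul_nonneg (abs_nonneg (μ x)) (hg0 x)) hg m).mul_left D
  refine Summable.of_norm_bounded h fun w => ?_
  have h1 := hf (List.ofFn w) (List.length_ofFn)
  rw [Real.norm_eq_abs, abs_mul, wprod, Finset.abs_prod, Finset.prod_mul_distrib]
  rw [List.map_ofFn, List.prod_ofFn] at h1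
  calc _ ≤ (∏ i, |μ (w i)|) * (D * ∏ i, g (w i)) :=
        mul_le_mul_of_nonneg_left h1 (Finset.prod_nonneg fun i _ => abs_nonneg _)
    _ = _ := by ring

/-- The product bound gives joint summability; the iterated sums then only have to identify the
value. -/
lemma hasSum_cons {μ g : X → ℝ} (hg : Summable fun x => |μ x| * g x)
    (hg0 : ∀ x, 0 ≤ g x) {m : ℕ} {k : X → List X → ℝ} {D : ℝ}
    (hk : ∀ v (t : List X), t.length = m → |k v t| ≤ D * (((v :: t).map g).prod))
    {G : X → ℝ} {a : ℝ}
    (h1 : ∀ v, HasSum (fun w : Fin m → X => wprod μ w * k v (List.ofFn w)) (G v))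
    (h2 : HasSum (fun v => μ v * G v) a) :
    HasSum (fun p : X × (Fin m → X) => μ p.1 * (wprod μ p.2 * k p.1 (List.ofFn p.2))) a := by
  have hs : Summable fun p : X × (Fin m → X) =>
      μ p.1 * (wprod μ p.2 * k p.1 (List.ofFn p.2)) := by
    have h := summable_of_le_prod (m := m + 1) hg hg0
      (f := fun l => match l with
        | [] => 0
        | v :: t => k v t) (D := D) (by
          rintro (_ | ⟨v, t⟩) hl
          · simp at hl
          · exact hk v t (by simpa using hl))
    rw [← (Fin.insertNthEquiv (fun _ => X) 0).summable_iff] at h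
    refine h.congr fun p => ?_
    simp [Fin.insertNthEquiv, wprod, Fin.prod_univ_succ, List.ofFn_succ, mul_assoc]
  have h3 := hs.hasSum.prod_fiberwise fun v => (h1 v).mul_left (μ v)
  rw [h2.unique h3]
  exact hs.hasSum

lemma hasSum_of_hasSum_cons {μ : X → ℝ} {m : ℕ} {f : List X → ℝ} {a : ℝ}
    (h : HasSum (fun p : X × (Fin m → X) =>
      μ p.1 * (wprod μ p.2 * f (p.1 :: List.ofFn p.2))) a) :
    HasSum (fun w : Fin (m + 1) → X => wprod μ w * f (List.ofFn w)) a := by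
  rw [← (Fin.insertNthEquiv (fun _ => X) 0).hasSum_iff]
  convert h using 2 with p
  simp [Fin.insertNthEquiv, wprod, Fin.prod_univ_succ, List.ofFn_succ, mul_assoc]

/-- Each of the m + 1 choices of the distinguished variable gives the same sum after relabelling. -/
lemma hasSum_splitSum {μ : X → ℝ} {m : ℕ} {k : X → List X → ℝ} {a : ℝ}
    (h : HasSum (fun p : X × (Fin m → X) =>
      μ p.1 * (wprod μ p.2 * k p.1 (List.ofFn p.2))) a) :
    HasSum (fun w : Fin (m + 1) → X => wprod μ w * splitSum k (List.ofFn w))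
      ((m + 1 : ℕ) * a) := by
  have key : ∀ j : Fin (m + 1), HasSum (fun w : Fin (m + 1) → X =>
      wprod μ w * k (w j) (List.ofFn fun i => w (j.succAbove i))) a := by
    intro j
    rw [← (Fin.insertNthEquiv (fun _ => X) j).hasSum_iff]
    convert h using 2 with p
    simp [Fin.insertNthEquiv, wprod, Fin.prod_univ_succAbove _ j, mul_assoc]
  have hs := hasSum_sum (s := Finset.univ) fun j _ => key j
  simp only [← Finset.mul_sum, ← splitSum_ofFn] at hs
  simpa using hs

end MultiSums

/-! ### Integrating variables out of a product of two Pfaffians. -/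

/-- An even number `2 m` of particles on `X` with weight `μ`, interaction `s` and functions `ψ`
that are skew orthogonal with normalization factors `u`. -/
structure SkewEnsemble (X : Type*) where
  μ : X → ℝ
  s : X → X → ℝ
  ψ : ℕ → X → ℝ
  m : ℕ
  u : ℕ → ℝ
  bound : ℝ
  s_swap : ∀ x y, s x y = -s y x
  abs_s_le : ∀ x y, |s x y| ≤ bound
  summable_ψ : ∀ k < 2 * m, Summable fun x => μ x * ψ k x
  u_ne_zero : ∀ k < m, u k ≠ 0
  even_even : ∀ j < m, ∀ k < m,
    ∑' x, μ x * ψ (2 * j) x * ∑' v, μ v * s x v * ψ (2 * k) v = 0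
  odd_odd : ∀ j < m, ∀ k < m,
    ∑' x, μ x * ψ (2 * j + 1) x * ∑' v, μ v * s x v * ψ (2 * k + 1) v = 0
  even_odd : ∀ j < m, ∀ k < m,
    ∑' x, μ x * ψ (2 * j) x * ∑' v, μ v * s x v * ψ (2 * k + 1) v = if j = k then u j else 0
  odd_even : ∀ j < m, ∀ k < m,
    ∑' x, μ x * ψ (2 * j + 1) x * ∑' v, μ v * s x v * ψ (2 * k) v = if j = k then -u j else 0

namespace SkewEnsemble

variable {X : Type*} (E : SkewEnsemble X)

/-- The transform `∫ s(y, v) ψ_k(v) μ(v)` of `ψ_k`. -/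
noncomputable def b (k : ℕ) (y : X) : ℝ := ∑' v, E.μ v * E.s y v * E.ψ k v

/-- The vector attached to a label. The labels `inl x` and `inr y` stand for the two rows of a
block. -/
noncomputable def vec : X ⊕ X → ℕ → ℝ
  | .inl x => fun k => E.ψ k x
  | .inr y => fun k => E.b k y

/-- `s` on labels of the second kind, zero on all other pairs of labels. -/
def ss : X ⊕ X → X ⊕ X → ℝ
  | .inr x, .inr y => E.s x y
  | _, _ => 0

/-- The entries of the matrix kernel. -/
noncomputable def kt (c d : X ⊕ X) : ℝ := symp E.m E.u (E.vec c) (E.vec d) - E.ss c d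

/-- The scalar kernel. -/
noncomputable def kk (x y : X) : ℝ := symp E.m E.u (fun k => E.ψ k x) fun k => E.ψ k y

/-- The Pfaffian of the matrix kernel on rows of the first kind at `x` (in reversed order),
followed by rows of the second kind at `y`. -/
noncomputable def mixed (x y : List X) : ℝ :=
  pf E.kt ((x.map .inl).reverse ++ y.map .inr)

lemma ss_swap (c d : X ⊕ X) : E.ss c d = -E.ss d c := by
  cases c <;> cases d <;> simp [ss]
  exact E.s_swap _ _

lemma kt_swap (c d : X ⊕ X) : E.kt c d = -E.kt d c := by
  rw [kt, kt, symp_swap, ss_swap]; ring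

lemma kk_swap (x y : X) : E.kk x y = -E.kk y x := symp_swap _ _ _ _

lemma kt_inl (x : X) (d : X ⊕ X) :
    E.kt (.inl x) d = symp E.m E.u (fun k => E.ψ k x) (E.vec d) := by
  simp [kt, ss, vec]

lemma abs_s_le' (x y : X) : |E.s x y| ≤ |E.bound| := (E.abs_s_le x y).trans (le_abs_self _)

lemma summable_s_mul (y : X) {k : ℕ} (hk : k < 2 * E.m) :
    Summable fun v => E.μ v * E.s y v * E.ψ k v := by
  refine Summable.of_norm_bounded ((E.summable_ψ k hk).abs.mul_left |E.bound|) fun v => ?_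
  rw [Real.norm_eq_abs, mul_right_comm, abs_mul, mul_comm]
  exact mul_le_mul_of_nonneg_right (E.abs_s_le' y v) (abs_nonneg _)

lemma abs_b_le (y : X) {k : ℕ} (hk : k < 2 * E.m) :
    |E.b k y| ≤ |E.bound| * ∑' v, |E.μ v * E.ψ k v| := by
  rw [← tsum_mul_left, b, ← Real.norm_eq_abs]
  refine tsum_of_norm_bounded ((E.summable_ψ k hk).abs.mul_left |E.bound|).hasSum fun v => ?_
  rw [Real.norm_eq_abs, mul_right_comm, abs_mul, mul_comm]
  exact mul_le_mul_of_nonneg_right (E.abs_s_le' y v) (abs_nonneg _)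

lemma hasSum_b (y : X) {k : ℕ} (hk : k < 2 * E.m) :
    HasSum (fun v => E.μ v * E.s y v * E.ψ k v) (E.b k y) :=
  (E.summable_s_mul y hk).hasSum

/-- The moments `⟨ψ_j, ψ_k⟩`. -/
noncomputable def gram (j k : ℕ) : ℝ := ∑' x, E.μ x * E.ψ j x * E.b k x

lemma hasSum_gram {j k : ℕ} (hj : j < 2 * E.m) (hk : k < 2 * E.m) :
    HasSum (fun x => E.μ x * E.ψ j x * E.b k x) (E.gram j k) := by
  refine Summable.hasSum ?_
  refine Summable.of_norm_bounded ((E.summable_ψ j hj).abs.mul_right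
    (|E.bound| * ∑' v, |E.μ v * E.ψ k v|)) fun v => ?_
  rw [Real.norm_eq_abs, abs_mul]
  exact mul_le_mul_of_nonneg_left (E.abs_b_le v hk) (abs_nonneg _)

/-- Integration against s(y, ·) turns ψ into its transform. This gives only the symplectic part of
the entry, hence the correction by `ss`. -/
lemma hasSum_kt_inr (y : X) (d : X ⊕ X) :
    HasSum (fun v => E.μ v * E.s y v * E.kt (.inl v) d) (E.kt (.inr y) d + E.ss (.inr y) d) := by
  simp only [kt_inl]
  have h := hasSum_symp_left (m := E.m) (u := E.u) (r := fun v => E.μ v * E.s y v)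
    (α := fun v k => E.ψ k v) (fun k hk => E.hasSum_b y hk) (E.vec d)
  refine hasSum_of_eq h (fun v => rfl) ?_
  rw [kt, sub_add_cancel]
  rfl

/-- By skew orthogonality a single term of the form survives, and its coefficient 1/u cancels the
skew product ±u. -/
lemma hasSum_reproducing_aux (β : ℕ → ℝ) {l : ℕ} (hl : l < 2 * E.m) :
    HasSum (fun v => E.μ v * symp E.m E.u (fun k => E.b k v) β * E.ψ l v) (-β l) := by
  have h := hasSum_symp_left (m := E.m) (u := E.u) (r := fun v => E.μ v * E.ψ l v)
    (α := fun v k => E.b k v) (fun k hk => E.hasSum_gram hl hk) β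
  refine hasSum_of_eq h (fun v => ?_) ?_
  · ring
  · rcases Nat.even_or_odd' l with ⟨i, rfl | rfl⟩
    · have hi : i < E.m := by omega
      rw [symp, Finset.sum_eq_single i]
      · have e1 : E.gram (2 * i) (2 * i) = 0 := E.even_even i hi i hi
        have e2 : E.gram (2 * i) (2 * i + 1) = E.u i := (E.even_odd i hi i hi).trans (if_pos rfl)
        have := E.u_ne_zero i hi
        rw [e1, e2]
        field_simp
        ring
      · intro k hk hki
        have hk := Finset.mem_range.1 hk
        have e1 : E.gram (2 * i) (2 * k) = 0 := E.even_even i hi k hk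
        have e2 : E.gram (2 * i) (2 * k + 1) = 0 :=
          (E.even_odd i hi k hk).trans (if_neg (Ne.symm hki))
        rw [e1, e2]
        ring
      · intro h
        exact absurd (Finset.mem_range.2 hi) h
    · have hi : i < E.m := by omega
      rw [symp, Finset.sum_eq_single i]
      · have e1 : E.gram (2 * i + 1) (2 * i + 1) = 0 := E.odd_odd i hi i hi
        have e2 : E.gram (2 * i + 1) (2 * i) = -E.u i := (E.odd_even i hi i hi).trans (if_pos rfl)
        have := E.u_ne_zero i hi
        rw [e1, e2]
        field_simp
        ring
      · intro k hk hki
        have hk := Finset.mem_range.1 hk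
        have e1 : E.gram (2 * i + 1) (2 * k + 1) = 0 := E.odd_odd i hi k hk
        have e2 : E.gram (2 * i + 1) (2 * k) = 0 :=
          (E.odd_even i hi k hk).trans (if_neg (Ne.symm hki))
        rw [e1, e2]
        ring
      · intro h
        exact absurd (Finset.mem_range.2 hi) h

lemma hasSum_reproducing (x : X) (d : X ⊕ X) :
    HasSum (fun v => E.μ v * E.kt (.inr v) (.inl x) * E.kt (.inl v) d) (-E.kt (.inl x) d) := by
  simp only [kt_inl]
  have h := hasSum_symp_left (m := E.m) (u := E.u)
    (r := fun v => E.μ v * symp E.m E.u (fun k => E.b k v) (fun k => E.ψ k x))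
    (α := fun v k => E.ψ k v) (fun k hk => E.hasSum_reproducing_aux (fun k => E.ψ k x) hk)
    (E.vec d)
  refine hasSum_of_eq h (fun v => ?_) ?_
  · simp [kt, ss, vec]
  · rw [symp, symp, ← Finset.sum_neg_distrib]
    exact Finset.sum_congr rfl fun k _ => by ring

/-- Each index k contributes (u_k + u_k)/u_k = 2. -/
lemma hasSum_trace :
    HasSum (fun v => E.μ v * E.kt (.inl v) (.inr v)) (2 * E.m : ℕ) := by
  have h : HasSum (fun v => ∑ k ∈ Finset.range E.m, (1 / E.u k) *
      (E.μ v * E.ψ (2 * k) v * E.b (2 * k + 1) v - E.μ v * E.ψ (2 * k + 1) v * E.b (2 * k) v))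
      (∑ k ∈ Finset.range E.m, (1 / E.u k) *
        (E.gram (2 * k) (2 * k + 1) - E.gram (2 * k + 1) (2 * k))) := by
    refine hasSum_sum fun k hk => ?_
    have hk := Finset.mem_range.1 hk
    exact ((E.hasSum_gram (by omega) (by omega)).sub
      (E.hasSum_gram (by omega) (by omega))).mul_left _
  refine hasSum_of_eq h (fun v => ?_) ?_
  · rw [kt_inl, symp, Finset.mul_sum]
    refine Finset.sum_congr rfl fun k _ => ?_
    simp only [vec]
    ring
  · rw [Finset.sum_congr rfl (g := fun _ => (2 : ℝ))]
    · simp [mul_comm]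
    · intro k hk
      have hk := Finset.mem_range.1 hk
      have e1 : E.gram (2 * k) (2 * k + 1) = E.u k := (E.even_odd k hk k hk).trans (if_pos rfl)
      have e2 : E.gram (2 * k + 1) (2 * k) = -E.u k := (E.odd_even k hk k hk).trans (if_pos rfl)
      have := E.u_ne_zero k hk
      rw [e1, e2]
      field_simp
      ring

/-- A function that dominates all `ψ_k`. -/
def dom (x : X) : ℝ := ∑ k ∈ Finset.range (2 * E.m), |E.ψ k x|

lemma dom_nonneg (x : X) : 0 ≤ E.dom x := Finset.sum_nonneg fun _ _ => abs_nonneg _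

lemma summable_dom : Summable fun x => |E.μ x| * E.dom x := by
  simp only [dom, Finset.mul_sum, ← abs_mul]
  exact summable_sum fun k hk => (E.summable_ψ k (Finset.mem_range.1 hk)).abs

lemma abs_ψ_le (x : X) {k : ℕ} (hk : k < 2 * E.m) : |E.ψ k x| ≤ E.dom x :=
  Finset.single_le_sum (f := fun k => |E.ψ k x|) (fun _ _ => abs_nonneg _) (Finset.mem_range.2 hk)

/-- A constant for the estimate of the scalar kernel. -/
noncomputable def kkBound : ℝ := 1 + ∑ k ∈ Finset.range E.m, |1 / E.u k| * 2

lemma one_le_kkBound : 1 ≤ E.kkBound :=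
  le_add_of_nonneg_right (Finset.sum_nonneg fun _ _ => by positivity)

/-- The summand 1 in `kkBound` ensures that the constant is at most its square, so that the bound
splits into one factor per point, as `abs_pf_le` requires. -/
lemma abs_kk_le (x y : X) : |E.kk x y| ≤ (E.kkBound * E.dom x) * (E.kkBound * E.dom y) := by
  have hxy := mul_nonneg (E.dom_nonneg x) (E.dom_nonneg y)
  have h1 : |E.kk x y| ≤ (∑ k ∈ Finset.range E.m, |1 / E.u k| * 2) * (E.dom x * E.dom y) := by
    rw [kk, symp, Finset.sum_mul]
    refine (Finset.abs_sum_le_sum_abs _ _).trans (Finset.sum_le_sum fun k hk => ?_)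
    have hk := Finset.mem_range.1 hk
    rw [abs_mul, mul_assoc]
    refine mul_le_mul_of_nonneg_left ?_ (abs_nonneg _)
    refine (abs_sub _ _).trans ?_
    rw [abs_mul, abs_mul, two_mul (E.dom x * E.dom y)]
    exact add_le_add
      (mul_le_mul (E.abs_ψ_le x (k := 2 * k) (by omega)) (E.abs_ψ_le y (k := 2 * k + 1) (by omega))
        (abs_nonneg _) (E.dom_nonneg x))
      (mul_le_mul (E.abs_ψ_le x (k := 2 * k + 1) (by omega)) (E.abs_ψ_le y (k := 2 * k) (by omega))
        (abs_nonneg _) (E.dom_nonneg x))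
  have h2 := E.one_le_kkBound
  calc _ ≤ E.kkBound * (E.dom x * E.dom y) := h1.trans
        (mul_le_mul_of_nonneg_right (le_add_of_nonneg_left zero_le_one) hxy)
    _ ≤ (E.kkBound * E.kkBound) * (E.dom x * E.dom y) :=
        mul_le_mul_of_nonneg_right (by nlinarith) hxy
    _ = _ := by ring

lemma prod_map_const_mul (c : ℝ) (g : X → ℝ) (l : List X) :
    (l.map fun x => c * g x).prod = c ^ l.length * (l.map g).prod := by
  induction l with
  | nil => simp
  | cons a l ih => simp [ih, pow_succ]; ring

/-- Only Pf[K] needs the dominating function, since s is bounded. The list `w'` is allowed to differ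
from `w` because an expansion removes a variable from Pf[s] alone. -/
lemma exists_abs_le (x y : List X) (m : ℕ) : ∃ D : ℝ, ∀ w w' : List X, w.length = m →
    w'.length ≤ m → |pf E.kk (x ++ w) * pf (fun c d => E.s d c) (w' ++ y)|
      ≤ D * (w.map E.dom).prod := by
  have hprod : ∀ l : List X, 0 ≤ (l.map E.dom).prod := by
    intro l
    apply List.prod_nonneg
    intro a ha
    obtain ⟨x, -, rfl⟩ := List.mem_map.1 ha
    exact E.dom_nonneg x
  have hk0 : 0 ≤ E.kkBound := zero_le_one.trans E.one_le_kkBound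
  refine ⟨((x.length + m).factorial * (E.kkBound ^ (x.length + m) * (x.map E.dom).prod)) *
    ((m + y.length).factorial * (1 + |E.bound|) ^ (m + y.length)), ?_⟩
  intro w w' hw hw'
  have h1 := abs_pf_le E.kk (fun x => E.kkBound * E.dom x)
    (fun x => mul_nonneg hk0 (E.dom_nonneg x)) E.abs_kk_le (x ++ w)
  rw [prod_map_const_mul, List.map_append, List.prod_append, List.length_append, hw] at h1
  have h2 := abs_pf_le (fun c d => E.s d c) (fun _ => 1 + |E.bound|) (fun _ => by positivity)
    (fun c d => (E.abs_s_le' d c).trans (by nlinarith [abs_nonneg E.bound])) (w' ++ y)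
  rw [List.map_const', List.prod_replicate, List.length_append] at h2
  have h3 : ((w'.length + y.length).factorial : ℝ) * (1 + |E.bound|) ^ (w'.length + y.length)
      ≤ (m + y.length).factorial * (1 + |E.bound|) ^ (m + y.length) := by
    apply mul_le_mul
    · exact_mod_cast Nat.factorial_le (by omega)
    · exact pow_le_pow_right₀ (le_add_of_nonneg_right (abs_nonneg _)) (by omega)
    · positivity
    · positivity
  rw [abs_mul]
  calc _ ≤ _ := mul_le_mul h1 (h2.trans h3) (abs_nonneg _) (by
        have := hprod x
        have := hprod w
        positivity)
    _ = _ := by ring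

lemma mixed_nil (x : List X) : E.mixed x [] = pf E.kk x.reverse := by
  rw [mixed, List.map_nil, List.append_nil, ← List.map_reverse, pf_map]
  congr 1
  funext v w
  rw [kt_inl]
  rfl

/-- Expand along the row of `v` on one side and of `y₁` on the other: they stand in the same place,
so the integral is taken entry by entry with `hasSum_kt_inr`. The correction `ss` sees only the
points of `y`. -/
lemma hasSum_mixed_cons (x : List X) (y₁ : X) (y : List X) :
    HasSum (fun v => E.μ v * E.s y₁ v * E.mixed (v :: x) y)
      (E.mixed x (y₁ :: y) + lap (fun e t => E.s y₁ e * E.mixed x t) y) := by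
  have e1 : ∀ c, pf E.kt ((x.map .inl).reverse ++ c :: y.map .inr)
      = lap (fun e t => E.kt c e * pf E.kt ((x.map .inl).reverse ++ t)) (y.map .inr)
        - lap (fun e t => E.kt c e * pf E.kt (t.reverse ++ y.map .inr)) (x.map .inl) :=
    fun c => pf_reverse_append_cons E.kt E.kt_swap _ _ _
  have e2 : ∀ v, E.mixed (v :: x) y
      = pf E.kt ((x.map .inl).reverse ++ .inl v :: y.map .inr) := by
    intro v
    simp [mixed]
  have e3 : E.mixed x (y₁ :: y)
      = pf E.kt ((x.map .inl).reverse ++ .inr y₁ :: y.map .inr) := by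
    simp [mixed]
  simp only [e2, e3, e1, mul_sub, ← lap_const_mul]
  have h1 : HasSum (fun v => lap (fun e t => E.μ v * E.s y₁ v *
      (E.kt (.inl v) e * pf E.kt ((x.map .inl).reverse ++ t))) (y.map .inr))
      (lap (fun e t => (E.kt (.inr y₁) e + E.ss (.inr y₁) e) *
        pf E.kt ((x.map .inl).reverse ++ t)) (y.map .inr)) := by
    apply hasSum_lap
    intro e t _
    simp only [← mul_assoc]
    exact (E.hasSum_kt_inr y₁ e).mul_right _
  have h2 : HasSum (fun v => lap (fun e t => E.μ v * E.s y₁ v *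
      (E.kt (.inl v) e * pf E.kt (t.reverse ++ y.map .inr))) (x.map .inl))
      (lap (fun e t => (E.kt (.inr y₁) e + E.ss (.inr y₁) e) *
        pf E.kt (t.reverse ++ y.map .inr)) (x.map .inl)) := by
    apply hasSum_lap
    intro e t _
    simp only [← mul_assoc]
    exact (E.hasSum_kt_inr y₁ e).mul_right _
  refine hasSum_of_eq (h1.sub h2) (fun v => rfl) ?_
  simp only [add_mul, lap_add]
  have h3 : lap (fun e t => E.ss (.inr y₁) e * pf E.kt (t.reverse ++ y.map .inr)) (x.map .inl)
      = 0 := by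
    rw [lap_map]
    exact lap_eq_zero fun e t _ => by simp [ss]
  have h4 : lap (fun e t => E.ss (.inr y₁) e * pf E.kt ((x.map .inl).reverse ++ t)) (y.map .inr)
      = lap (fun e t => E.s y₁ e * E.mixed x t) y := lap_map _ _ _
  rw [h3, h4]
  ring

/-- For empty `y` this is the rank of the kernel. Otherwise a point of `y` is traded for an integral
over one more point of `x`, which is still above the rank. -/
lemma mixed_eq_zero (y x : List X) (hx : 2 * E.m < x.length) : E.mixed x y = 0 := by
  generalize hn : y.length = n
  induction n using Nat.strong_induction_on generalizing x y with
  | _ n ih =>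
    cases y with
    | nil =>
      rw [mixed_nil]
      exact pf_symp_eq_zero _ _ _ _ (by simpa using hx)
    | cons y₁ y =>
      simp only [List.length_cons] at hn
      have h := E.hasSum_mixed_cons x y₁ y
      rw [lap_eq_zero fun e t hp => by
        have := hp.length_eq
        simp only [List.length_cons] at this
        rw [ih t.length (by omega) t x hx rfl, mul_zero], add_zero] at h
      have h0 : (fun v => E.μ v * E.s y₁ v * E.mixed (v :: x) y) = fun _ => 0 := by
        funext v
        rw [ih y.length (by omega) y (v :: x) (by simp; omega) rfl, mul_zero]
      rw [h0] at h
      exact h.unique hasSum_zero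

/-- Expand along the second row of `v`. Pairing it with the first row of `v` gives the trace 2m.
Pairing it with a point of `x` lets that point replace `v` by the reproducing property, which
contributes -1 for each point of `x`. -/
lemma hasSum_mixed_singleton (x : List X) (hx : x.length ≤ 2 * E.m) :
    HasSum (fun v => E.μ v * E.mixed (v :: x) [v])
      ((2 * E.m - x.length : ℕ) * E.mixed x []) := by
  have hA := pf_alternates E.kt E.kt_swap
  have e1 : ∀ v, E.mixed (v :: x) [v] = E.kt (.inl v) (.inr v) * E.mixed x []
      + lap (fun e t => E.kt (.inr v) e * pf E.kt (t.reverse ++ [.inl v])) (x.map .inl) := by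
    intro v
    have := pf_reverse_append_cons E.kt E.kt_swap (.inl v :: x.map .inl) (.inr v) []
    simp only [lap_nil, zero_sub, lap_cons, List.append_nil, List.reverse_cons] at this
    rw [mixed, mixed, E.kt_swap (.inl v)]
    simp only [List.map_cons, List.reverse_cons, List.map_nil, List.append_nil]
    rw [this]
    ring
  have e2 : ∀ (t : List (X ⊕ X)) (c : X ⊕ X), pf E.kt (t.reverse ++ [c])
      = -lap (fun d t' => E.kt c d * pf E.kt t'.reverse) t := by
    intro t c
    have := pf_reverse_append_cons E.kt E.kt_swap t c []
    simpa using this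
  have h1 : HasSum (fun v => lap (fun e t => E.μ v *
      (E.kt (.inr v) e * pf E.kt (t.reverse ++ [.inl v]))) (x.map .inl))
      (lap (fun e t => -pf E.kt (t.reverse ++ [e])) (x.map .inl)) := by
    apply hasSum_lap
    intro e t hp
    obtain ⟨x', -, rfl⟩ := List.mem_map.1 (hp.subset List.mem_cons_self)
    simp only [e2, mul_neg, ← lap_const_mul, ← lap_neg]
    apply hasSum_lap
    intro d t' _
    have := ((E.hasSum_reproducing x' d).mul_right (pf E.kt t'.reverse)).neg
    refine hasSum_of_eq this (fun v => ?_) ?_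
    · ring
    · ring
  have h2 := (E.hasSum_trace.mul_right (E.mixed x [])).add h1
  refine hasSum_of_eq h2 (fun v => ?_) ?_
  · rw [e1, mul_add, lap_const_mul, mul_assoc]
  · rw [lap_neg, hA.lap_reverse_append, List.length_map, Nat.cast_sub hx]
    simp only [mixed, List.map_nil]
    ring

/-- Induction on the number of integrated variables and, inside it, on the length of `y`. The list
`y` may grow only when a variable is used up. -/
theorem hasSum_mixed (m' : ℕ) (y x : List X) (h : x.length + m' = 2 * E.m) :
    HasSum (fun w : Fin m' → X => wprod E.μ w *
      (pf E.kk (x.reverse ++ List.ofFn w) *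
        pf (fun c d => E.s d c) ((List.ofFn w).reverse ++ y)))
      (m'.factorial * E.mixed x y) := by
  have hs : ∀ c d, (fun c d => E.s d c) c d = -(fun c d => E.s d c) d c := fun c d => E.s_swap d c
  induction m' generalizing x y with
  | zero =>
    generalize hn : y.length = n
    induction n using Nat.strong_induction_on generalizing y with
    | _ n ih =>
      cases y with
      | nil =>
        have : HasSum (fun w : Fin 0 → X => wprod E.μ w *
          (pf E.kk (x.reverse ++ List.ofFn w) *
            pf (fun c d => E.s d c) ((List.ofFn w).reverse ++ []))) _ := hasSum_fintype _
        refine hasSum_of_eq this (fun w => rfl) ?_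
        simp [wprod, mixed_nil]
      | cons y₁ y =>
        simp only [List.length_cons] at hn
        have h1 := E.hasSum_mixed_cons x y₁ y
        -- Here `x` already has 2m points, so one more exceeds the rank. The identity of
        -- `hasSum_mixed_cons` becomes the row expansion of Pf[s].
        have h0 : (fun v => E.μ v * E.s y₁ v * E.mixed (v :: x) y) = fun _ => 0 := by
          funext v
          rw [E.mixed_eq_zero y (v :: x) (by simp; omega), mul_zero]
        rw [h0] at h1
        have h2 := h1.unique hasSum_zero
        have h3 : HasSum (fun w : Fin 0 → X => lap (fun e t => -E.s y₁ e * (wprod E.μ w *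
          (pf E.kk (x.reverse ++ List.ofFn w) *
            pf (fun c d => E.s d c) ((List.ofFn w).reverse ++ t)))) y)
            (lap (fun e t => -E.s y₁ e * (Nat.factorial 0 * E.mixed x t)) y) := by
          apply hasSum_lap
          intro e t hp
          have := hp.length_eq
          simp only [List.length_cons] at this
          exact (ih t.length (by omega) t rfl).mul_left _
        refine hasSum_of_eq h3 (fun w => ?_) ?_
        · have : (fun e t => -E.s y₁ e * (wprod E.μ w *
            (pf E.kk (x.reverse ++ List.ofFn w) *
              pf (fun c d => E.s d c) ((List.ofFn w).reverse ++ t))))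
              = fun e t => (wprod E.μ w * pf E.kk (x.reverse ++ List.ofFn w)) *
                (E.s e y₁ * pf (fun c d => E.s d c) ((List.ofFn w).reverse ++ t)) := by
            funext e t
            rw [E.s_swap y₁ e]
            ring
          rw [this, lap_const_mul]
          simp only [List.ofFn_zero, List.reverse_nil, List.nil_append, pf_cons]
          ring
        · simp only [Nat.factorial_zero, Nat.cast_one, one_mul, neg_mul, lap_neg]
          linarith
  | succ m' ih0 =>
    generalize hn : y.length = n
    induction n using Nat.strong_induction_on generalizing y with
    | _ n ih =>
      have hk := pf_alternates E.kk E.kk_swap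
      cases y with
      | nil =>
        apply hasSum_of_hasSum_cons (f := fun l => pf E.kk (x.reverse ++ l) *
          pf (fun c d => E.s d c) (l.reverse ++ []))
        obtain ⟨D, hD⟩ := E.exists_abs_le x.reverse [] (m' + 1)
        have h1 := E.hasSum_mixed_singleton x (by omega)
        refine hasSum_cons E.summable_dom E.dom_nonneg (D := D)
          (k := fun v t => pf E.kk (x.reverse ++ v :: t) *
            pf (fun c d => E.s d c) ((v :: t).reverse ++ []))
          (fun v t ht => hD (v :: t) (v :: t).reverse (by simp [ht]) (by simp [ht]))
          (G := fun v => m'.factorial * E.mixed (v :: x) [v]) ?_ ?_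
        · intro v
          -- The first variable stands last in the reversed list, so it becomes a fixed point of
          -- both Pfaffians.
          have := ih0 [v] (v :: x) (by simp; omega)
          simpa using this
        · refine hasSum_of_eq (h1.mul_left (m'.factorial : ℝ)) (fun v => ?_) ?_
          · ring
          · have : 2 * E.m - x.length = m' + 1 := by omega
            rw [this, Nat.factorial_succ]
            push_cast
            ring
      | cons y₁ y =>
        simp only [List.length_cons] at hn
        have h1 := E.hasSum_mixed_cons x y₁ y
        -- The terms in which `y₁` is paired with another point of `y`.
        have h3 : HasSum (fun w : Fin (m' + 1) → X => lap (fun e t => -E.s y₁ e *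
          (wprod E.μ w * (pf E.kk (x.reverse ++ List.ofFn w) *
            pf (fun c d => E.s d c) ((List.ofFn w).reverse ++ t)))) y)
            (lap (fun e t => -E.s y₁ e * ((m' + 1).factorial * E.mixed x t)) y) := by
          apply hasSum_lap
          intro e t hp
          have := hp.length_eq
          simp only [List.length_cons] at this
          exact (ih t.length (by omega) t rfl).mul_left _
        obtain ⟨D, hD⟩ := E.exists_abs_le x.reverse y (m' + 1)
        -- The terms in which `y₁` is paired with a variable: it leaves Pf[s] together with `y₁` and
        -- becomes a fixed point of Pf[K].
        have h4 : HasSum (fun p : X × (Fin m' → X) => E.μ p.1 * (wprod E.μ p.2 *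
            (pf E.kk (x.reverse ++ p.1 :: List.ofFn p.2) * (E.s y₁ p.1 *
              pf (fun c d => E.s d c) ((List.ofFn p.2).reverse ++ y)))))
            (m'.factorial * (E.mixed x (y₁ :: y) + lap (fun e t => E.s y₁ e * E.mixed x t) y)) := by
          refine hasSum_cons E.summable_dom E.dom_nonneg (D := |E.bound| * D)
            (k := fun v t => pf E.kk (x.reverse ++ v :: t) * (E.s y₁ v *
              pf (fun c d => E.s d c) (t.reverse ++ y)))
            (fun v t ht => ?_)
            (G := fun v => m'.factorial * (E.s y₁ v * E.mixed (v :: x) y)) ?_ ?_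
          · have := hD (v :: t) t.reverse (by simp [ht]) (by simp [ht])
            rw [mul_left_comm, abs_mul, mul_assoc]
            exact mul_le_mul (E.abs_s_le' y₁ v) this (abs_nonneg _) (abs_nonneg _)
          · intro v
            have := (ih0 y (v :: x) (by simp; omega)).mul_left (E.s y₁ v)
            refine hasSum_of_eq this (fun w => ?_) ?_
            · simp only [List.reverse_cons, List.append_assoc, List.cons_append, List.nil_append]
              ring
            · ring
          · refine hasSum_of_eq (h1.mul_left (m'.factorial : ℝ)) (fun v => ?_) rfl
            ring
        have h5 := h3.add (hasSum_splitSum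
          (k := fun v t => pf E.kk (x.reverse ++ v :: t) * (E.s y₁ v *
              pf (fun c d => E.s d c) (t.reverse ++ y))) h4)
        refine hasSum_of_eq h5 (fun w => ?_) ?_
        · rw [← (hk.prepend x.reverse).mul_lap (fun v t => E.s y₁ v *
              pf (fun c d => E.s d c) (t.reverse ++ y)), pf_reverse_append_cons _ hs]
          have : (fun e t => -E.s y₁ e * (wprod E.μ w *
            (pf E.kk (x.reverse ++ List.ofFn w) *
              pf (fun c d => E.s d c) ((List.ofFn w).reverse ++ t))))
              = fun e t => (wprod E.μ w * pf E.kk (x.reverse ++ List.ofFn w)) *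
                (E.s e y₁ * pf (fun c d => E.s d c) ((List.ofFn w).reverse ++ t)) := by
            funext e t
            rw [E.s_swap y₁ e]
            ring
          have h6 : (fun (v : X) (t : List X) =>
                E.s y₁ v * pf (fun c d => E.s d c) (t.reverse ++ y))
              = fun v t => -(E.s v y₁ * pf (fun c d => E.s d c) (t.reverse ++ y)) := by
            funext v t
            rw [E.s_swap y₁ v]
            ring
          rw [this, lap_const_mul, h6, lap_neg]
          ring
        · have : (fun e t => -E.s y₁ e * (((m' + 1).factorial : ℝ) * E.mixed x t))
              = fun e t => -((m' + 1).factorial : ℝ) * (E.s y₁ e * E.mixed x t) := by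
            funext e t
            ring
          rw [this, lap_const_mul, Nat.factorial_succ]
          push_cast
          ring

end SkewEnsemble

/-! ### The Jackson integrals as absolutely convergent lattice sums. -/

section Lattice

variable (q : ℝ) (ω : ℝ → ℝ)

lemma sKer_swap (i j : ℤ) : sKer q i j = -sKer q j i := by
  unfold sKer
  rcases Int.emod_two_eq_zero_or_one i with hi | hi <;>
  rcases Int.emod_two_eq_zero_or_one j with hj | hj <;>
  simp [hi, hj] <;> split_ifs <;> simp

lemma abs_sKer_le (i j : ℤ) : |sKer q i j| ≤ (1 + √q) ^ 2 := by
  unfold sKer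
  have h : (0 : ℝ) ≤ (1 + √q) ^ 2 := sq_nonneg _
  split_ifs <;> simp [abs_of_nonneg h, h]

lemma abs_Ffun_le (i : ℤ) : |Ffun q i| ≤ 1 + √q := by
  have h : 0 ≤ 1 + √q := by positivity
  unfold Ffun
  split_ifs
  · rw [abs_of_nonneg h]
  · simpa using h

/-- The weight of a lattice point in the Jackson integral against `ω`. -/
noncomputable def latticeWeight (i : ℤ) : ℝ := (1 - √q) * pt q i * ω (pt q i)

/-- The values of a polynomial on the lattice, times the weights. -/
noncomputable def latticeFun (φ : Polynomial ℝ) (i : ℤ) : ℝ :=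
  latticeWeight q ω i * φ.eval (pt q i)

lemma latticeFun_sub_C_mul (φ χ : Polynomial ℝ) (c : ℝ) (i : ℤ) :
    latticeFun q ω (φ - Polynomial.C c * χ) i = latticeFun q ω φ i - c * latticeFun q ω χ i := by
  simp [latticeFun]
  ring

lemma summable_latticeFun {d : ℕ} (hmom : HasMoments q ω d) (φ : Polynomial ℝ)
    (hφ : φ.natDegree ≤ d) : Summable (latticeFun q ω φ) := by
  have h : ∀ i, latticeFun q ω φ i = ∑ k ∈ Finset.range (d + 1),
      (1 - √q) * φ.coeff k * (pt q i * (pt q i ^ k * ω (pt q i))) := by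
    intro i
    rw [latticeFun, latticeWeight, Polynomial.eval_eq_sum_range' (Nat.lt_succ_of_le hφ),
      Finset.mul_sum]
    exact Finset.sum_congr rfl fun k _ => by ring
  rw [funext h]
  refine summable_sum fun k hk => (hmom k ?_).mul_left _
  exact Nat.lt_succ_iff.1 (Finset.mem_range.1 hk)

/-- The skew form of `s` on weighted lattice functions. -/
noncomputable def skewForm (a b : ℤ → ℝ) : ℝ := ∑' i, a i * ∑' j, sKer q i j * b j

variable {a a' b : ℤ → ℝ}

lemma summable_skewForm (ha : Summable a) (hb : Summable b) :
    Summable fun i => a i * ∑' j, sKer q i j * b j := by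
  refine Summable.of_norm_bounded (ha.abs.mul_right ((1 + √q) ^ 2 * ∑' j, |b j|)) fun i => ?_
  rw [Real.norm_eq_abs, abs_mul]
  refine mul_le_mul_of_nonneg_left ?_ (abs_nonneg _)
  rw [← tsum_mul_left, ← Real.norm_eq_abs]
  refine tsum_of_norm_bounded (hb.abs.mul_left ((1 + √q) ^ 2)).hasSum fun j => ?_
  rw [Real.norm_eq_abs, abs_mul]
  exact mul_le_mul_of_nonneg_right (abs_sKer_le q i j) (abs_nonneg _)

/-- Boundedness of s makes the double sum absolutely convergent, so the order of summation can be
exchanged. -/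
lemma skewForm_swap (ha : Summable a) (hb : Summable b) :
    skewForm q a b = -skewForm q b a := by
  have hs : Summable (Function.uncurry fun i j => a i * (sKer q i j * b j)) := by
    refine Summable.of_norm_bounded ((ha.abs.mul_of_nonneg hb.abs (fun _ => abs_nonneg _)
      fun _ => abs_nonneg _).mul_left ((1 + √q) ^ 2)) fun p => ?_
    simp only [Function.uncurry, Real.norm_eq_abs, abs_mul]
    have := mul_le_mul_of_nonneg_right (abs_sKer_le q p.1 p.2)
      (mul_nonneg (abs_nonneg (a p.1)) (abs_nonneg (b p.2)))
    calc _ = |sKer q p.1 p.2| * (|a p.1| * |b p.2|) := by ring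
      _ ≤ _ := this
  simp only [skewForm, ← tsum_mul_left]
  rw [← hs.tsum_comm, ← tsum_neg]
  refine tsum_congr fun j => ?_
  rw [← tsum_neg]
  refine tsum_congr fun i => ?_
  rw [sKer_swap q j i]
  ring

lemma skewForm_sub_mul (c : ℝ) (ha : Summable a) (ha' : Summable a') (hb : Summable b) :
    skewForm q (fun i => a i - c * a' i) b = skewForm q a b - c * skewForm q a' b := by
  rw [skewForm, skewForm, skewForm, ← tsum_mul_left,
    ← (summable_skewForm q ha hb).tsum_sub ((summable_skewForm q ha' hb).mul_left c)]
  exact tsum_congr fun i => by ring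

lemma skewInner_eq (φ ψ : Polynomial ℝ) :
    skewInner q ω φ ψ = skewForm q (latticeFun q ω φ) (latticeFun q ω ψ) := by
  simp only [skewInner, jackson, skewForm, ← tsum_mul_left]
  refine tsum_congr fun i => tsum_congr fun j => ?_
  simp only [latticeFun, latticeWeight]
  ring

lemma beta_eq (Q : ℕ → Polynomial ℝ) (k : ℕ) :
    beta q ω Q k = ∑' i, latticeFun q ω (Q k) i * Ffun q i := by
  simp only [beta, jackson, ← tsum_mul_left]
  refine tsum_congr fun i => ?_
  simp only [latticeFun, latticeWeight]
  ring

lemma summable_mul_Ffun (ha : Summable a) : Summable fun i => a i * Ffun q i := by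
  refine Summable.of_norm_bounded (ha.abs.mul_right (1 + √q)) fun i => ?_
  rw [Real.norm_eq_abs, abs_mul]
  exact mul_le_mul_of_nonneg_left (abs_Ffun_le q i) (abs_nonneg _)

end Lattice

/-! ### Skew products and F-integrals of the modified polynomials. -/

section Modified

variable {q : ℝ} {ω : ℝ → ℝ} {n : ℕ} {Q : ℕ → Polynomial ℝ} {u : ℕ → ℝ}

lemma exists_Qhat_eq (k : ℕ) : ∃ c : ℝ, Qhat q ω n Q k = Q k - Polynomial.C c * Q (2 * n) ∧
    (k = 2 * n → c = 0) ∧ (k ≠ 2 * n → c = beta q ω Q k / beta q ω Q (2 * n)) := by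
  by_cases h : k = 2 * n
  · exact ⟨0, by simp [Qhat, h], fun _ => rfl, fun h' => absurd h h'⟩
  · exact ⟨_, by rw [Qhat, if_neg h], fun h' => absurd h' h, fun _ => rfl⟩

variable (hmom : HasMoments q ω (2 * n)) (hQ : IsMonicSkewOrthogonal q ω (2 * n) Q u)

include hmom hQ in
lemma summable_latticeFun_Q {k : ℕ} (hk : k ≤ 2 * n) : Summable (latticeFun q ω (Q k)) :=
  summable_latticeFun q ω hmom _ ((hQ.natDegree_eq k hk).le.trans hk)

include hmom hQ in
lemma summable_latticeFun_Qhat {k : ℕ} (hk : k ≤ 2 * n) :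
    Summable (latticeFun q ω (Qhat q ω n Q k)) := by
  obtain ⟨c, hc, -⟩ := exists_Qhat_eq (q := q) (ω := ω) (n := n) (Q := Q) k
  rw [hc, funext (latticeFun_sub_C_mul q ω _ _ c)]
  exact (summable_latticeFun_Q hmom hQ hk).sub
    ((summable_latticeFun_Q hmom hQ le_rfl).mul_left c)

include hQ in
lemma skewForm_Q_last {k : ℕ} (hk : k ≤ 2 * n) :
    skewForm q (latticeFun q ω (Q (2 * n))) (latticeFun q ω (Q k)) = 0 := by
  rw [← skewInner_eq]
  rcases Nat.even_or_odd' k with ⟨l, rfl | rfl⟩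
  · exact hQ.even_even n l le_rfl hk
  · rw [hQ.even_odd n l le_rfl hk, if_neg (by omega)]

include hmom hQ in
-- The modification adds multiples of Q_{2n}, which is skew orthogonal to everything of index at
-- most 2n.
lemma skewForm_Qhat {j k : ℕ} (hj : j ≤ 2 * n) (hk : k ≤ 2 * n) :
    skewForm q (latticeFun q ω (Qhat q ω n Q j)) (latticeFun q ω (Qhat q ω n Q k))
      = skewInner q ω (Q j) (Q k) := by
  obtain ⟨c, hc, -⟩ := exists_Qhat_eq (q := q) (ω := ω) (n := n) (Q := Q) j
  obtain ⟨d, hd, -⟩ := exists_Qhat_eq (q := q) (ω := ω) (n := n) (Q := Q) k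
  have sj := summable_latticeFun_Q hmom hQ hj
  have sk := summable_latticeFun_Q hmom hQ hk
  have sn := summable_latticeFun_Q hmom hQ (le_refl (2 * n))
  have skh := summable_latticeFun_Qhat hmom hQ hk
  have key : ∀ l, l ≤ 2 * n → skewForm q (latticeFun q ω (Q l))
      (latticeFun q ω (Qhat q ω n Q k)) = skewInner q ω (Q l) (Q k) := by
    intro l hl
    have sl := summable_latticeFun_Q hmom hQ hl
    rw [skewForm_swap q sl skh, hd, funext (latticeFun_sub_C_mul q ω _ _ d),
      skewForm_sub_mul q d sk sn sl, skewForm_Q_last hQ hl, skewInner_eq,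
      skewForm_swap q sk sl]
    ring
  rw [hc, funext (latticeFun_sub_C_mul q ω _ _ c), skewForm_sub_mul q c sj sn skh, key j hj,
    key _ le_rfl, skewInner_eq q ω (Q (2 * n)), skewForm_Q_last hQ hk]
  ring

include hmom hQ in
lemma tsum_Qhat_mul_Ffun (hβ : beta q ω Q (2 * n) ≠ 0) {k : ℕ} (hk : k ≤ 2 * n) :
    ∑' i, latticeFun q ω (Qhat q ω n Q k) i * Ffun q i
      = if k = 2 * n then beta q ω Q (2 * n) else 0 := by
  obtain ⟨c, hc, h1, h2⟩ := exists_Qhat_eq (q := q) (ω := ω) (n := n) (Q := Q) k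
  have sk := summable_mul_Ffun q (summable_latticeFun_Q hmom hQ hk)
  have sn := summable_mul_Ffun q (summable_latticeFun_Q hmom hQ (le_refl (2 * n)))
  have : ∀ i, latticeFun q ω (Qhat q ω n Q k) i * Ffun q i
      = latticeFun q ω (Q k) i * Ffun q i - c * (latticeFun q ω (Q (2 * n)) i * Ffun q i) := by
    intro i
    rw [hc, latticeFun_sub_C_mul]
    ring
  rw [tsum_congr this, sk.tsum_sub (sn.mul_left c), tsum_mul_left, ← beta_eq, ← beta_eq]
  split_ifs with h
  · rw [h1 h, h]; ring
  · rw [h2 h]; field_simp; ring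

end Modified

/-! ### The even ensemble on the lattice with one additional point. -/

section Ensemble

variable (q : ℝ) (ω : ℝ → ℝ) (n : ℕ) (Q : ℕ → Polynomial ℝ) (u : ℕ → ℝ)

/-- The weight on the lattice with an additional point `none` of weight one. -/
noncomputable def extWeight : Option ℤ → ℝ
  | some i => latticeWeight q ω i
  | none => 1

/-- The extension of `s` by `s(x, none) = F(x)`. -/
noncomputable def extS : Option ℤ → Option ℤ → ℝ
  | some i, some j => sKer q i j
  | some i, none => Ffun q i
  | none, some j => -Ffun q j
  | none, none => 0

/-- The functions `Q̂_k`, `k ≤ 2n`, extended by zero, and the indicator function of `none`. -/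
noncomputable def extFun (k : ℕ) : Option ℤ → ℝ
  | some i => if k ≤ 2 * n then (Qhat q ω n Q k).eval (pt q i) else 0
  | none => if k = 2 * n + 1 then 1 else 0

/-- The factors `u_0, …, u_{n-1}, β_{2n}`. -/
noncomputable def extFactor (k : ℕ) : ℝ := if k < n then u k else beta q ω Q (2 * n)

/-- The transforms of the functions `extFun`. -/
noncomputable def extTransform (k : ℕ) (x : Option ℤ) : ℝ :=
  ∑' v, extWeight q ω v * extS q x v * extFun q ω n Q k v

variable {q ω n Q u}

lemma tsum_option_of_none {f : Option ℤ → ℝ} (h : f none = 0) : ∑' x, f x = ∑' i, f (some i) := by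
  refine ((Option.some_injective ℤ).tsum_eq fun x hx => ?_).symm
  cases x with
  | none => exact absurd h hx
  | some i => exact ⟨i, rfl⟩

lemma tsum_option_of_some {f : Option ℤ → ℝ} (h : ∀ i, f (some i) = 0) : ∑' x, f x = f none := by
  refine tsum_eq_single none fun x hx => ?_
  cases x with
  | none => exact absurd rfl hx
  | some i => exact h i

lemma extFun_none {k : ℕ} (hk : k ≤ 2 * n) : extFun q ω n Q k none = 0 := by
  simp only [extFun]
  rw [if_neg (by omega)]

lemma extFun_some {k : ℕ} (hk : k ≤ 2 * n) (i : ℤ) :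
    extFun q ω n Q k (some i) = (Qhat q ω n Q k).eval (pt q i) := by
  simp only [extFun]
  rw [if_pos hk]

lemma extFun_last_some (i : ℤ) : extFun q ω n Q (2 * n + 1) (some i) = 0 := by
  simp [extFun]

lemma extFun_last_none : extFun q ω n Q (2 * n + 1) none = 1 := by
  simp [extFun]

lemma extTransform_eq {k : ℕ} (hk : k ≤ 2 * n) (x : Option ℤ) :
    extTransform q ω n Q k x
      = ∑' j, extS q x (some j) * latticeFun q ω (Qhat q ω n Q k) j := by
  rw [extTransform, tsum_option_of_none (by rw [extFun_none hk, mul_zero])]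
  refine tsum_congr fun j => ?_
  rw [extFun_some hk, latticeFun, extWeight]
  ring

lemma extTransform_last (x : Option ℤ) : extTransform q ω n Q (2 * n + 1) x = extS q x none := by
  rw [extTransform, tsum_option_of_some fun i => by rw [extFun_last_some, mul_zero],
    extFun_last_none, extWeight]
  ring

/-- The sign comes from the order of the arguments: `Phi` integrates over the first argument of s,
`extTransform` over the second. -/
lemma extTransform_some {k : ℕ} (hk : k ≤ 2 * n) (i : ℤ) :
    extTransform q ω n Q k (some i) = -Phi q ω n Q k i := by
  rw [extTransform_eq hk, Phi, jackson, ← tsum_mul_left, ← tsum_neg]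
  refine tsum_congr fun j => ?_
  rw [extS, latticeFun, latticeWeight, sKer_swap]
  ring

variable (hmom : HasMoments q ω (2 * n)) (hQ : IsMonicSkewOrthogonal q ω (2 * n) Q u)
  (hβ : beta q ω Q (2 * n) ≠ 0)

include hmom hQ hβ in
lemma extTransform_none {k : ℕ} (hk : k ≤ 2 * n) :
    extTransform q ω n Q k none = if k = 2 * n then -beta q ω Q (2 * n) else 0 := by
  rw [extTransform_eq hk]
  have : ∀ j, extS q none (some j) * latticeFun q ω (Qhat q ω n Q k) j
      = -(latticeFun q ω (Qhat q ω n Q k) j * Ffun q j) := by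
    intro j
    rw [extS]
    ring
  rw [tsum_congr this, tsum_neg, tsum_Qhat_mul_Ffun hmom hQ hβ hk]
  split_ifs <;> simp

lemma tsum_extFun_mul_last (j : ℕ) (hj : j ≤ 2 * n) :
    ∑' x, extWeight q ω x * extFun q ω n Q j x * extTransform q ω n Q (2 * n + 1) x
      = ∑' i, latticeFun q ω (Qhat q ω n Q j) i * Ffun q i := by
  rw [tsum_option_of_none (by rw [extFun_none hj]; ring)]
  refine tsum_congr fun i => ?_
  rw [extTransform_last, extFun_some hj, extS, extWeight, latticeFun]

lemma tsum_extFun_mul (j k : ℕ) (hj : j ≤ 2 * n) (hk : k ≤ 2 * n) :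
    ∑' x, extWeight q ω x * extFun q ω n Q j x * extTransform q ω n Q k x
      = skewForm q (latticeFun q ω (Qhat q ω n Q j)) (latticeFun q ω (Qhat q ω n Q k)) := by
  rw [tsum_option_of_none (by rw [extFun_none hj]; ring)]
  refine tsum_congr fun i => ?_
  rw [extTransform_eq hk, extFun_some hj, extWeight, latticeFun]
  rfl

lemma tsum_last_mul (k : ℕ) :
    ∑' x, extWeight q ω x * extFun q ω n Q (2 * n + 1) x * extTransform q ω n Q k x
      = extTransform q ω n Q k none := by
  rw [tsum_option_of_some fun i => by rw [extFun_last_some]; ring, extFun_last_none, extWeight]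
  ring

include hmom hQ in
lemma summable_extFun (k : ℕ) : Summable fun x => extWeight q ω x * extFun q ω n Q k x := by
  by_cases hk : k ≤ 2 * n
  · rw [← (Option.some_injective ℤ).summable_iff]
    · refine (summable_latticeFun_Qhat hmom hQ hk).congr fun i => ?_
      simp only [Function.comp, extFun_some hk, extWeight, latticeFun]
    · intro x hx
      cases x with
      | none => rw [extFun_none hk, mul_zero]
      | some i => exact absurd ⟨i, rfl⟩ hx
  · refine summable_of_ne_finset_zero (s := {none}) fun x hx => ?_
    cases x with
    | none => simp at hx
    | some i => simp [extFun, hk]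

/-- The `2n+1` particles together with a particle at the additional point. -/
noncomputable def ensemble : SkewEnsemble (Option ℤ) where
  μ := extWeight q ω
  s := extS q
  ψ := extFun q ω n Q
  m := n + 1
  u := extFactor q ω n Q u
  bound := (1 + √q) ^ 2 + (1 + √q)
  s_swap := by
    intro x y
    cases x <;> cases y <;> simp only [extS, neg_neg, neg_zero]
    exact sKer_swap q _ _
  abs_s_le := by
    intro x y
    have h : 0 ≤ 1 + √q := by positivity
    have h2 := sq_nonneg (1 + √q)
    cases x <;> cases y <;> simp only [extS, abs_neg, abs_zero]
    · positivity
    · exact (abs_Ffun_le q _).trans (le_add_of_nonneg_left h2)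
    · exact (abs_Ffun_le q _).trans (le_add_of_nonneg_left h2)
    · exact (abs_sKer_le q _ _).trans (le_add_of_nonneg_right h)
  summable_ψ := fun k _ => summable_extFun hmom hQ k
  u_ne_zero := by
    intro k _
    unfold extFactor
    split_ifs with h
    · exact hQ.factor_ne_zero k (by omega)
    · exact hβ
  even_even := by
    intro j hj k hk
    exact (tsum_extFun_mul _ _ (by omega) (by omega)).trans
      ((skewForm_Qhat hmom hQ (by omega) (by omega)).trans
        (hQ.even_even j k (by omega) (by omega)))
  odd_odd := by
    intro j hj k hk
    rcases Nat.lt_succ_iff_lt_or_eq.1 hj with hj | rfl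
    · rcases Nat.lt_succ_iff_lt_or_eq.1 hk with hk | rfl
      · exact (tsum_extFun_mul _ _ (by omega) (by omega)).trans
          ((skewForm_Qhat hmom hQ (by omega) (by omega)).trans
            (hQ.odd_odd j k (by omega) (by omega)))
      -- Here the second function is the indicator of `none`, with transform F, and the product is
      -- the integral of Q̂ against F.
      · exact (tsum_extFun_mul_last _ (by omega)).trans
          ((tsum_Qhat_mul_Ffun hmom hQ hβ (by omega)).trans (if_neg (by omega)))
    · refine (tsum_last_mul _).trans ?_
      rcases Nat.lt_succ_iff_lt_or_eq.1 hk with hk | rfl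
      · rw [extTransform_none hmom hQ hβ (by omega), if_neg (by omega)]
      · rw [extTransform_last, extS]
  even_odd := by
    intro j hj k hk
    rcases Nat.lt_succ_iff_lt_or_eq.1 hk with hk | rfl
    · refine (tsum_extFun_mul _ _ (by omega) (by omega)).trans
        ((skewForm_Qhat hmom hQ (by omega) (by omega)).trans
          ((hQ.even_odd j k (by omega) (by omega)).trans ?_))
      split_ifs with h
      · rw [extFactor, if_pos (by omega)]
      · rfl
    · refine (tsum_extFun_mul_last _ (by omega)).trans
        ((tsum_Qhat_mul_Ffun hmom hQ hβ (by omega)).trans ?_)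
      by_cases h : j = k
      · rw [if_pos (by omega), if_pos h, extFactor, if_neg (by omega)]
      · rw [if_neg (by omega), if_neg h]
  odd_even := by
    intro j hj k hk
    rcases Nat.lt_succ_iff_lt_or_eq.1 hj with hj | rfl
    · refine (tsum_extFun_mul _ _ (by omega) (by omega)).trans ?_
      rw [skewForm_swap q (summable_latticeFun_Qhat hmom hQ (by omega))
        (summable_latticeFun_Qhat hmom hQ (by omega)),
        skewForm_Qhat hmom hQ (by omega) (by omega), hQ.even_odd k j (by omega) (by omega)]
      by_cases h : j = k
      · rw [if_pos h.symm, if_pos h, extFactor, if_pos (by omega), h]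
      · rw [if_neg (Ne.symm h), if_neg h, neg_zero]
    · refine (tsum_last_mul _).trans ?_
      rw [extTransform_none hmom hQ hβ (by omega)]
      by_cases h : j = k
      · rw [if_pos (by omega), if_pos h, extFactor, if_neg (by omega)]
      · rw [if_neg (by omega), if_neg h]

end Ensemble

/-! ### Rearrangements of the arguments of alternating functions. -/

section MoreLists

variable {α : Type*}

lemma Alternates.eq_zero_of_repeat {F : List α → ℝ} (hF : Alternates F) (a : α)
    (l₁ l₂ l₃ : List α) : F (l₁ ++ a :: (l₂ ++ a :: l₃)) = 0 := by
  have h1 := ((hF.prepend l₁).cons a).move_left l₂ a l₃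
  have h2 := hF l₁ a a (l₂ ++ l₃)
  have h3 : F (l₁ ++ a :: a :: (l₂ ++ l₃)) = 0 := by linarith
  rw [h1, h3, mul_zero]

lemma Alternates.mul_move_right {F G : List α → ℝ} (hF : Alternates F) (hG : Alternates G)
    (l₁ : List α) (c : α) (l₂ : List α) :
    F (l₁ ++ c :: l₂) * G (l₁ ++ c :: l₂) = F (l₁ ++ l₂ ++ [c]) * G (l₁ ++ l₂ ++ [c]) := by
  have hsq : ∀ k : ℕ, ((-1 : ℝ) ^ k) * (-1) ^ k = 1 := fun k => by
    rw [← mul_pow]; simp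
  rw [hF.move_left l₁, hG.move_left l₁, hF.move_left (l₁ ++ l₂), hG.move_left (l₁ ++ l₂),
    List.append_nil, mul_mul_mul_comm, hsq, mul_mul_mul_comm, hsq]

/-- The mirror order of the first labels puts the two labels of one point next to each other in the
middle; this pair moves out without a sign. -/
lemma Alternates.interleave {X : Type*} {F : List (X ⊕ X) → ℝ} (hF : Alternates F)
    (x : List X) (r : List (X ⊕ X)) :
    F ((x.map .inl).reverse ++ (x.map .inr ++ r))
      = F (x.reverse.flatMap (fun v => [.inl v, .inr v]) ++ r) := by
  induction x generalizing r with
  | nil => rfl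
  | cons c x ih =>
    have h1 := hF.move_pair (.inl c) (.inr c) (x.map .inl).reverse (x.map .inr) r
    have h2 := ih (.inl c :: .inr c :: r)
    simp only [List.map_cons, List.reverse_cons, List.append_assoc, List.cons_append,
      List.nil_append, List.flatMap_append, List.flatMap_cons, List.flatMap_nil,
      List.append_nil] at h1 h2 ⊢
    rw [h1, h2]

end MoreLists

/-! ### Identification of the matrix kernel and removal of the additional point. -/

section Kernel

variable {q : ℝ} {ω : ℝ → ℝ} {n : ℕ} {Q : ℕ → Polynomial ℝ} {u : ℕ → ℝ}
variable (hmom : HasMoments q ω (2 * n)) (hQ : IsMonicSkewOrthogonal q ω (2 * n) Q u)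
  (hβ : beta q ω Q (2 * n) ≠ 0)

/-- The label of a row of the block at a lattice point. -/
def label (i : ℤ) (r : Fin 2) : Option ℤ ⊕ Option ℤ :=
  if r = 0 then .inl (some i) else .inr (some i)

lemma symp_extFactor (α β : ℕ → ℝ) : symp (n + 1) (extFactor q ω n Q u) α β
    = (∑ k ∈ Finset.range n, (1 / u k) *
        (α (2 * k) * β (2 * k + 1) - α (2 * k + 1) * β (2 * k)))
      + (1 / beta q ω Q (2 * n)) *
        (α (2 * n) * β (2 * n + 1) - α (2 * n + 1) * β (2 * n)) := by
  rw [symp, Finset.sum_range_succ, extFactor, if_neg (lt_irrefl n)]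
  congr 1
  refine Finset.sum_congr rfl fun k hk => ?_
  rw [extFactor, if_pos (Finset.mem_range.1 hk)]

lemma kt_inl_inl (i j : ℤ) : (ensemble hmom hQ hβ).kt (.inl (some i)) (.inl (some j))
    = Kodd q ω n Q u i j := by
  refine (SkewEnsemble.kt_inl _ _ _).trans ((symp_extFactor _ _).trans ?_)
  change _ + (1 / beta q ω Q (2 * n)) * (_ * extFun q ω n Q (2 * n + 1) (some j)
    - extFun q ω n Q (2 * n + 1) (some i) * _) = _
  rw [extFun_last_some, extFun_last_some, mul_zero, zero_mul, sub_zero, mul_zero, add_zero]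
  refine Finset.sum_congr rfl fun k hk => ?_
  have hk := Finset.mem_range.1 hk
  change (1 / u k) * (extFun q ω n Q (2 * k) (some i) * extFun q ω n Q (2 * k + 1) (some j)
    - extFun q ω n Q (2 * k + 1) (some i) * extFun q ω n Q (2 * k) (some j)) = _
  simp only [extFun_some (show 2 * k ≤ 2 * n by omega),
    extFun_some (show 2 * k + 1 ≤ 2 * n by omega)]

lemma kt_inl_inr (i j : ℤ) : (ensemble hmom hQ hβ).kt (.inl (some i)) (.inr (some j))
    = Jodd q ω n Q u j i := by
  refine (SkewEnsemble.kt_inl _ _ _).trans ((symp_extFactor _ _).trans ?_)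
  change _ + (1 / beta q ω Q (2 * n)) * (extFun q ω n Q (2 * n) (some i) *
      extTransform q ω n Q (2 * n + 1) (some j)
    - extFun q ω n Q (2 * n + 1) (some i) * _) = _
  rw [extFun_last_some, zero_mul, sub_zero, extFun_some le_rfl, extTransform_last, Jodd, extS,
    mul_comm (Ffun q j)]
  congr 1
  refine Finset.sum_congr rfl fun k hk => ?_
  have hk := Finset.mem_range.1 hk
  change (1 / u k) * (extFun q ω n Q (2 * k) (some i) * extTransform q ω n Q (2 * k + 1) (some j)
    - extFun q ω n Q (2 * k + 1) (some i) * extTransform q ω n Q (2 * k) (some j)) = _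
  rw [extFun_some (show 2 * k ≤ 2 * n by omega),
    extFun_some (show 2 * k + 1 ≤ 2 * n by omega),
    extTransform_some (show 2 * k ≤ 2 * n by omega),
    extTransform_some (show 2 * k + 1 ≤ 2 * n by omega)]
  ring

lemma kt_inr_inr (i j : ℤ) : (ensemble hmom hQ hβ).kt (.inr (some i)) (.inr (some j))
    = -Iodd q ω n Q u i j := by
  refine (congrArg (· - sKer q i j) (symp_extFactor _ _)).trans ?_
  change _ + (1 / beta q ω Q (2 * n)) * (extTransform q ω n Q (2 * n) (some i) *
      extTransform q ω n Q (2 * n + 1) (some j)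
    - extTransform q ω n Q (2 * n + 1) (some i) * extTransform q ω n Q (2 * n) (some j))
    - _ = _
  rw [extTransform_last, extTransform_last, extTransform_some le_rfl, extTransform_some le_rfl,
    extS, extS, Iodd, neg_add, neg_add, ← Finset.sum_neg_distrib]
  have : ∀ k ∈ Finset.range n, (1 / u k) * (extTransform q ω n Q (2 * k) (some i) *
        extTransform q ω n Q (2 * k + 1) (some j)
      - extTransform q ω n Q (2 * k + 1) (some i) * extTransform q ω n Q (2 * k) (some j))
      = -((1 / u k) * (Phi q ω n Q (2 * k + 1) i * Phi q ω n Q (2 * k) j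
        - Phi q ω n Q (2 * k) i * Phi q ω n Q (2 * k + 1) j)) := by
    intro k hk
    have hk := Finset.mem_range.1 hk
    rw [extTransform_some (show 2 * k ≤ 2 * n by omega),
      extTransform_some (show 2 * k + 1 ≤ 2 * n by omega),
      extTransform_some (show 2 * k ≤ 2 * n by omega),
      extTransform_some (show 2 * k + 1 ≤ 2 * n by omega)]
    ring
  rw [← Finset.sum_congr rfl this]
  change (∑ k ∈ Finset.range n, (1 / u k) * (extTransform q ω n Q (2 * k) (some i) *
        extTransform q ω n Q (2 * k + 1) (some j)
      - extTransform q ω n Q (2 * k + 1) (some i) * extTransform q ω n Q (2 * k) (some j))) +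
      _ - _ = _
  ring

lemma Ktilde_eq (i j : ℤ) (r c : Fin 2) :
    Ktilde q ω n Q u i j r c = (ensemble hmom hQ hβ).kt (label i r) (label j c) := by
  fin_cases r <;> fin_cases c
  · exact (kt_inl_inl hmom hQ hβ i j).symm
  · exact (kt_inl_inr hmom hQ hβ i j).symm
  · refine Eq.trans ?_ (SkewEnsemble.kt_swap _ _ _).symm
    exact congrArg Neg.neg (kt_inl_inr hmom hQ hβ j i).symm
  · exact (kt_inr_inr hmom hQ hβ i j).symm

include hmom hQ hβ in
lemma Ktilde_transpose (i j : ℤ) :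
    (Ktilde q ω n Q u i j).transpose = -Ktilde q ω n Q u j i := by
  ext r c
  rw [Matrix.transpose_apply, Matrix.neg_apply, Ktilde_eq hmom hQ hβ, Ktilde_eq hmom hQ hβ]
  exact SkewEnsemble.kt_swap _ _ _

lemma pfaffian_blockMatrix {k : ℕ} (z : Fin k → ℤ) :
    pfaffian (blockMatrix (Ktilde q ω n Q u) z)
      = (ensemble hmom hQ hβ).mixed ((List.ofFn z).map some).reverse
          ((List.ofFn z).map some).reverse := by
  have hA := pf_alternates _ (ensemble hmom hQ hβ).kt_swap
  have h1 := hA.interleave ((List.ofFn z).map some).reverse []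
  rw [List.append_nil, List.append_nil, List.reverse_reverse] at h1
  rw [SkewEnsemble.mixed, h1]
  have h2 : blockMatrix (Ktilde q ω n Q u) z = fun a b => (ensemble hmom hQ hβ).kt
      (label (z ⟨a.1 / 2, by omega⟩) ⟨a.1 % 2, Nat.mod_lt _ two_pos⟩)
      (label (z ⟨b.1 / 2, by omega⟩) ⟨b.1 % 2, Nat.mod_lt _ two_pos⟩) := by
    funext a b
    exact Ktilde_eq hmom hQ hβ _ _ _ _
  rw [h2]
  refine (pfaffian_eq_pf _ (ensemble hmom hQ hβ).kt_swap (fun a : Fin (2 * k) =>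
    label (z ⟨a.1 / 2, by omega⟩) ⟨a.1 % 2, Nat.mod_lt _ two_pos⟩)).trans ?_
  congr 1
  rw [List.ofFn_mul', List.flatMap_def, List.map_map, List.map_ofFn]
  congr 2
  funext i
  have h3 : (2 * i.1 + 1) / 2 = i.1 := by omega
  simp [List.ofFn_succ, label, h3]

include hmom hQ hβ in
-- The transforms at `none` vanish except at index 2n, where the value is -β_{2n}.
lemma symp_extTransform_none (β : ℕ → ℝ) :
    symp (n + 1) (extFactor q ω n Q u) (fun k => extTransform q ω n Q k none) β
      = -β (2 * n + 1) := by
  rw [symp_extFactor, Finset.sum_eq_zero, extTransform_none hmom hQ hβ le_rfl, if_pos rfl,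
    extTransform_last, extS]
  · field_simp
    ring
  · intro k hk
    have hk := Finset.mem_range.1 hk
    rw [extTransform_none hmom hQ hβ (by omega), extTransform_none hmom hQ hβ (by omega),
      if_neg (by omega), if_neg (by omega)]
    ring

lemma kt_inr_none_inl (x : Option ℤ) : (ensemble hmom hQ hβ).kt (.inr none) (.inl x)
    = -extFun q ω n Q (2 * n + 1) x := by
  refine (congrArg (· - (0 : ℝ)) (symp_extTransform_none hmom hQ hβ _)).trans ?_
  exact sub_zero _

lemma kt_inr_none_inr (j : ℤ) : (ensemble hmom hQ hβ).kt (.inr none) (.inr (some j)) = 0 := by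
  refine (congrArg (· - (-Ffun q j)) (symp_extTransform_none hmom hQ hβ _)).trans ?_
  change -extTransform q ω n Q (2 * n + 1) (some j) - -Ffun q j = 0
  rw [extTransform_last, extS]
  ring

/-- The second row of `none` has its only nonzero entry, -1, at the first row of `none`; expansion
along it deletes both rows. -/
lemma mixed_none_cons (l : List ℤ) :
    (ensemble hmom hQ hβ).mixed (none :: l.map some) (none :: l.map some)
      = (ensemble hmom hQ hβ).mixed (l.map some) (l.map some) := by
  have h := pf_reverse_append_cons _ (ensemble hmom hQ hβ).kt_swap
    (.inl none :: (l.map some).map .inl) (.inr none) ((l.map some).map .inr)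
  rw [lap_cons, lap_eq_zero, lap_eq_zero, kt_inr_none_inl, extFun_last_none] at h
  · refine h.trans ?_
    rw [SkewEnsemble.mixed]
    ring
  · intro e t hp
    have he := hp.subset (List.mem_cons_self (a := e))
    simp only [List.mem_map] at he
    obtain ⟨_, ⟨i, -, rfl⟩, rfl⟩ := he
    rw [kt_inr_none_inl, extFun_last_some, neg_zero, zero_mul]
  · intro e t hp
    have he := hp.subset (List.mem_cons_self (a := e))
    simp only [List.mem_map] at he
    obtain ⟨_, ⟨i, -, rfl⟩, rfl⟩ := he
    rw [kt_inr_none_inr, zero_mul]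

end Kernel

/-! ### The joint density as a product of two Pfaffians, and its integrals. -/

section Density

variable {q : ℝ} {ω : ℝ → ℝ} {n : ℕ} {Q : ℕ → Polynomial ℝ} {u : ℕ → ℝ}

/-- A configuration on the lattice, followed by the additional point. -/
def extConfig (Z : Fin (2 * n + 1) → ℤ) (a : Fin (2 * n + 1 + 1)) : Option ℤ :=
  if h : a.1 < 2 * n + 1 then some (Z ⟨a.1, h⟩) else none

lemma extConfig_castSucc (Z : Fin (2 * n + 1) → ℤ) (i : Fin (2 * n + 1)) :
    extConfig Z i.castSucc = some (Z i) := by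
  rw [extConfig, dif_pos (show i.castSucc.1 < 2 * n + 1 from i.2)]
  rfl

lemma extConfig_last (Z : Fin (2 * n + 1) → ℤ) : extConfig Z (Fin.last _) = none := by
  simp [extConfig]

lemma ofFn_extConfig (Z : Fin (2 * n + 1) → ℤ) :
    List.ofFn (extConfig Z) = (List.ofFn Z).map some ++ [none] := by
  rw [List.ofFn_succ', extConfig_last, List.concat_eq_append, List.map_ofFn]
  congr 2
  funext i
  exact extConfig_castSucc Z i

lemma pfaffian_borderedMatrix (Z : Fin (2 * n + 1) → ℤ) :
    pfaffian (borderedMatrix q n Z) = pf (extS q) ((List.ofFn Z).map some ++ [none]) := by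
  have h : borderedMatrix q n Z = fun a b : Fin (2 * (n + 1)) =>
      extS q (extConfig Z a) (extConfig Z b) := by
    funext a b
    unfold borderedMatrix extConfig
    split_ifs <;> rfl
  have hs : ∀ x y, extS q x y = -extS q y x := by
    intro x y
    cases x <;> cases y <;> simp only [extS, neg_neg, neg_zero]
    exact sKer_swap q _ _
  rw [h, ← ofFn_extConfig]
  exact pfaffian_eq_pf (extS q) hs (m := n + 1) (extConfig Z)

/-- The row of `none` is the last unit vector. -/
lemma det_extFun (Z : Fin (2 * n + 1) → ℤ) :
    (Matrix.of fun i j : Fin (2 * n + 1 + 1) => extFun q ω n Q j (extConfig Z i)).det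
      = (Matrix.of fun i j : Fin (2 * n + 1) => (Qhat q ω n Q j).eval (pt q (Z i))).det := by
  rw [Matrix.det_succ_row _ (Fin.last _), Fin.sum_univ_castSucc, Finset.sum_eq_zero]
  · have h1 : (Matrix.of fun i j : Fin (2 * n + 1 + 1) => extFun q ω n Q j (extConfig Z i))
        (Fin.last _) (Fin.last _) = 1 := by
      rw [Matrix.of_apply, extConfig_last, Fin.val_last, extFun_last_none]
    have h2 : (-1 : ℝ) ^ ((Fin.last (2 * n + 1) : ℕ) + (Fin.last (2 * n + 1) : ℕ)) = 1 :=
      Even.neg_one_pow (Even.add_self _)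
    rw [zero_add, h1, h2, one_mul, one_mul]
    congr 1
    ext i j
    rw [Matrix.submatrix_apply, Matrix.of_apply, Matrix.of_apply, Fin.succAbove_last,
      extConfig_castSucc, extFun_some (by rw [Fin.val_castSucc]; omega)]
    rfl
  · intro j _
    rw [Matrix.of_apply, extConfig_last, extFun_none (by simp; omega), mul_zero, zero_mul]

/-- Multiples of the last column, that of Q_{2n}, are subtracted from the others. -/
lemma det_Qhat (Z : Fin (2 * n + 1) → ℤ) :
    (Matrix.of fun i j : Fin (2 * n + 1) => (Qhat q ω n Q j).eval (pt q (Z i))).det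
      = (Matrix.of fun i j : Fin (2 * n + 1) => (Q j).eval (pt q (Z i))).det := by
  choose c hc h0 _ using fun k => exists_Qhat_eq (q := q) (ω := ω) (n := n) (Q := Q) k
  rw [← Matrix.det_transpose, ← Matrix.det_transpose (Matrix.of fun i j : Fin (2 * n + 1) =>
    (Q j).eval (pt q (Z i)))]
  refine Matrix.det_eq_of_forall_row_eq_smul_add_const (fun i => -c i) (Fin.last (2 * n)) ?_ ?_
  · rw [h0 _ (Fin.val_last _), neg_zero]
  · intro i j
    simp only [Matrix.transpose_apply, Matrix.of_apply, Fin.val_last]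
    rw [hc, Polynomial.eval_sub, Polynomial.eval_mul, Polynomial.eval_C]
    ring

variable (hmom : HasMoments q ω (2 * n)) (hQ : IsMonicSkewOrthogonal q ω (2 * n) Q u)
  (hβ : beta q ω Q (2 * n) ≠ 0)

/-- The value of the partition function. -/
noncomputable def tauValue (q : ℝ) (ω : ℝ → ℝ) (n : ℕ) (Q : ℕ → Polynomial ℝ) (u : ℕ → ℝ) : ℝ :=
  beta q ω Q (2 * n) * ∏ j ∈ Finset.range n, u j

include hQ hβ in
lemma tauValue_ne_zero : tauValue q ω n Q u ≠ 0 := by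
  refine mul_ne_zero hβ (Finset.prod_ne_zero_iff.2 fun k hk => hQ.factor_ne_zero k ?_)
  have := Finset.mem_range.1 hk
  omega

/-- Monic polynomials give the same determinant as monomials, and the constant in `pf_symp_eq_det`
is the inverse of `tauValue`. -/
lemma vandermonde_eq (Z : Fin (2 * n + 1) → ℤ) :
    ∏ i, ∏ j ∈ Finset.Ioi i, (pt q (Z j) - pt q (Z i))
      = tauValue q ω n Q u * pf (ensemble hmom hQ hβ).kk ((List.ofFn Z).map some ++ [none]) := by
  rw [← Matrix.det_vandermonde (fun i => pt q (Z i)),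
    Matrix.det_eval_matrixOfPolynomials_eq_det_vandermonde _ (fun i : Fin (2 * n + 1) => Q i)
      (fun i => hQ.natDegree_eq i (by omega)) (fun i => hQ.monic i (by omega)),
    ← det_Qhat (ω := ω), ← det_extFun, ← ofFn_extConfig]
  have h1 : pf (ensemble hmom hQ hβ).kk (List.ofFn (extConfig Z))
      = (∏ k ∈ Finset.range (n + 1), (1 / extFactor q ω n Q u k)) *
        (Matrix.of fun i j : Fin (2 * n + 1 + 1) => extFun q ω n Q j (extConfig Z i)).det :=
    pf_symp_eq_det (n + 1) (extFactor q ω n Q u) (extFun q ω n Q) (extConfig Z)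
  have h2 : tauValue q ω n Q u * ∏ k ∈ Finset.range (n + 1), (1 / extFactor q ω n Q u k) = 1 := by
    have h3 : tauValue q ω n Q u = ∏ k ∈ Finset.range (n + 1), extFactor q ω n Q u k := by
      rw [Finset.prod_range_succ, extFactor, if_neg (lt_irrefl n), tauValue, mul_comm]
      congr 1
      refine Finset.prod_congr rfl fun k hk => ?_
      rw [extFactor, if_pos (Finset.mem_range.1 hk)]
    have h4 := tauValue_ne_zero hQ hβ
    rw [h3] at h4 ⊢
    rw [Finset.prod_div_distrib, Finset.prod_const_one, mul_one_div, div_self h4]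
  rw [h1, ← mul_assoc, h2, one_mul]

lemma jointWeight_eq (Z : Fin (2 * n + 1) → ℤ) :
    jointWeight q ω n Z = tauValue q ω n Q u * (∏ i, ω (pt q (Z i))) *
      (pf (ensemble hmom hQ hβ).kk ((List.ofFn Z).map some ++ [none]) *
        pf (extS q) ((List.ofFn Z).map some ++ [none])) := by
  rw [jointWeight, pfaffian_borderedMatrix, vandermonde_eq hmom hQ hβ]
  ring

lemma ofFn_extend {N k : ℕ} (hk : k ≤ N) (z : Fin k → ℤ) (w : Fin (N - k) → ℤ) :
    List.ofFn (extend z w) = List.ofFn z ++ List.ofFn w := by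
  apply List.ext_getElem
  · simp; omega
  · intro i h1 h2
    rw [List.getElem_append]
    simp only [List.getElem_ofFn, extend, List.length_ofFn]

lemma prod_extend {N k : ℕ} (hk : k ≤ N) (z : Fin k → ℤ) (w : Fin (N - k) → ℤ) (f : ℤ → ℝ) :
    ∏ i, f (extend z w i) = (∏ i, f (z i)) * ∏ i, f (w i) := by
  have h : ∀ (m : ℕ) (v : Fin m → ℤ), ∏ i, f (v i) = ((List.ofFn v).map f).prod := by
    intro m v
    rw [List.map_ofFn, List.prod_ofFn]
    rfl
  rw [h, ofFn_extend hk, List.map_append, List.prod_append, ← h, ← h]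

/-- `none` is moved from the end to just after the fixed points; both Pfaffians change by the same
sign. -/
lemma jacksonTerm_extend {k : ℕ} (hk : k ≤ 2 * n + 1) (z : Fin k → ℤ)
    (w : Fin (2 * n + 1 - k) → ℤ) :
    jacksonTerm q (fun w => jointWeight q ω n (extend z w)) w
      = tauValue q ω n Q u * (∏ i, ω (pt q (z i))) * (wprod (extWeight q ω) (some ∘ w) *
        (pf (ensemble hmom hQ hβ).kk
          (((List.ofFn z).map some ++ [none]) ++ List.ofFn (some ∘ w)) *
        pf (extS q) (((List.ofFn z).map some ++ [none]) ++ List.ofFn (some ∘ w)))) := by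
  have h1 := (pf_alternates _ (ensemble hmom hQ hβ).kk_swap).mul_move_right
    (pf_alternates _ (ensemble hmom hQ hβ).s_swap) ((List.ofFn z).map some) none
    (List.ofFn (some ∘ w))
  have h2 : (List.ofFn (extend z w)).map some
      = (List.ofFn z).map some ++ List.ofFn (some ∘ w) := by
    rw [ofFn_extend hk, List.map_append, List.map_ofFn, List.map_ofFn]
  rw [List.append_assoc, List.singleton_append]
  have h3 : wprod (extWeight q ω) (some ∘ w)
      = (∏ l, (1 - √q) * pt q (w l)) * ∏ l, ω (pt q (w l)) := by
    rw [← Finset.prod_mul_distrib]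
    rfl
  rw [jacksonTerm, jointWeight_eq hmom hQ hβ, prod_extend hk z w (fun i => ω (pt q i)), h2, h3]
  refine Eq.trans ?_ (congrArg _ (congrArg _ h1.symm))
  change _ = _ * (_ * (_ * pf (extS q) _))
  ring

include hmom hQ hβ in
lemma hasSum_jacksonTerm {k : ℕ} (hk : k ≤ 2 * n + 1) (z : Fin k → ℤ) :
    HasSum (jacksonTerm q fun w : Fin (2 * n + 1 - k) → ℤ => jointWeight q ω n (extend z w))
      (tauValue q ω n Q u * (∏ i, ω (pt q (z i))) * ((2 * n + 1 - k).factorial *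
        pfaffian (blockMatrix (Ktilde q ω n Q u) z))) := by
  have hm : ((none : Option ℤ) :: ((List.ofFn z).reverse.map some)).length + (2 * n + 1 - k)
      = 2 * (ensemble hmom hQ hβ).m := by
    change _ = 2 * (n + 1)
    simp
    omega
  have h1 := (ensemble hmom hQ hβ).hasSum_mixed (2 * n + 1 - k)
    (none :: ((List.ofFn z).reverse.map some)) _ hm
  rw [mixed_none_cons, List.map_reverse, ← pfaffian_blockMatrix, List.reverse_cons,
    List.reverse_reverse] at h1
  have hinj : Function.Injective fun w : Fin (2 * n + 1 - k) → ℤ => (some ∘ w : _ → Option ℤ) :=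
    (Option.some_injective ℤ).comp_left
  -- The general theorem sums over configurations on the extended lattice. Those outside the lattice
  -- contain `none` again, besides the fixed one, and Pf[K] vanishes on them.
  rw [← hinj.hasSum_iff] at h1
  · refine hasSum_of_eq (h1.mul_left _) (fun w => ?_) rfl
    rw [jacksonTerm_extend hmom hQ hβ hk]
    have h2 := pf_flip_reverse _ (ensemble hmom hQ hβ).s_swap
      (((List.ofFn z).map some ++ [none]) ++ List.ofFn (some ∘ w))
    have h3 : (((List.ofFn z).map some ++ [none]) ++ List.ofFn (some ∘ w)).reverse
        = (List.ofFn (some ∘ w)).reverse ++ none :: ((List.ofFn z).map some).reverse := by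
      simp
    rw [h3] at h2
    simp only [Function.comp_def] at h2 ⊢
    rw [h2]
    rfl
  · intro w hw
    have hmem : (none : Option ℤ) ∈ List.ofFn w := by
      by_contra hne
      apply hw
      have hsome : ∀ i, ∃ j, some j = w i := by
        intro i
        refine Option.ne_none_iff_exists.1 fun h => hne ?_
        rw [List.mem_ofFn]
        exact ⟨i, h⟩
      choose w' hw' using hsome
      exact ⟨w', funext hw'⟩
    obtain ⟨l₂, l₃, hl⟩ := List.append_of_mem hmem
    have h0 := (pf_alternates _ (ensemble hmom hQ hβ).kk_swap).eq_zero_of_repeat none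
      ((List.ofFn z).map some) l₂ l₃
    rw [hl, List.append_assoc, List.singleton_append, h0]
    ring

end Density

end QOrth

theorem mainTheorem6 (q : ℝ) (hq0 : 0 < q) (hq1 : q < 1) (ω : ℝ → ℝ) (n : ℕ)
    (hmom : QOrth.HasMoments q ω (2 * n))
    (Q : ℕ → Polynomial ℝ) (u : ℕ → ℝ)
    (hQ : QOrth.IsMonicSkewOrthogonal q ω (2 * n) Q u)
    (hβ : QOrth.beta q ω Q (2 * n) ≠ 0) :
    (Summable (QOrth.jacksonTerm q (QOrth.jointWeight q ω n)) ∧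
      QOrth.partitionFunction q ω n
        = QOrth.beta q ω Q (2 * n) * ∏ j ∈ Finset.range n, u j) ∧
    (∀ x y : ℤ, (QOrth.Ktilde q ω n Q u x y).transpose = -QOrth.Ktilde q ω n Q u y x) ∧
    (∀ k : ℕ, k ≤ 2 * n + 1 → ∀ z : Fin k → ℤ,
      Summable (QOrth.jacksonTerm q fun w : Fin (2 * n + 1 - k) → ℤ =>
        QOrth.jointWeight q ω n (QOrth.extend z w)) ∧
      QOrth.corr q ω n k z
        = (∏ l, ω (QOrth.pt q (z l))) *
          QOrth.pfaffian (QOrth.blockMatrix (QOrth.Ktilde q ω n Q u) z)) := by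
  -- Without fixed points the Pfaffian of the kernel is 1, and the integral is (2n+1)! times the
  -- partition function.
  have h0 := QOrth.hasSum_jacksonTerm hmom hQ hβ (Nat.zero_le _) Fin.elim0
  have hext : (fun w : Fin (2 * n + 1 - 0) → ℤ => QOrth.jointWeight q ω n
      (QOrth.extend Fin.elim0 w)) = QOrth.jointWeight q ω n := by
    funext w
    congr 1
  have hpf : QOrth.pfaffian (QOrth.blockMatrix (QOrth.Ktilde q ω n Q u) Fin.elim0) = 1 := by
    rw [QOrth.pfaffian_blockMatrix hmom hQ hβ]
    rfl
  rw [hext, hpf, Finset.univ_eq_empty, Finset.prod_empty, mul_one, mul_one] at h0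
  have hτ : QOrth.partitionFunction q ω n = QOrth.tauValue q ω n Q u := by
    rw [QOrth.partitionFunction, QOrth.jacksonMulti]
    refine (congrArg _ h0.tsum_eq).trans ?_
    have : ((2 * n + 1).factorial : ℝ) ≠ 0 := by positivity
    rw [Nat.sub_zero]
    field_simp
  refine ⟨⟨h0.summable, hτ⟩, QOrth.Ktilde_transpose hmom hQ hβ, fun k hk z => ?_⟩
  have hz := QOrth.hasSum_jacksonTerm hmom hQ hβ hk z
  refine ⟨hz.summable, ?_⟩
  rw [QOrth.corr, QOrth.jacksonMulti, hz.tsum_eq, hτ]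
  have h1 := QOrth.tauValue_ne_zero hQ hβ
  have h2 : ((2 * n + 1 - k).factorial : ℝ) ≠ 0 := by positivity
  field_simp
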